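/- Let $n\in\mathbb N$ and $2\le p<n$, put $p'=\frac{p}{p-1}$, $p^*=\frac{np}{n-p}$ and $$v(r)=\kappa_0\,(1+r^{p'})^{-(n-p)/p}\qquad(r\ge 0),$$ where $\kappa_0>0$ is the constant for which $x\mapsto v(|x|)$ has norm $1$ in $L^{p^*}(\mathbb R^n)$. Let $\mu\ge 0$ (for instance an eigenvalue of $-\Delta$ on the sphere $\mathbb S^{n-1}$), and for $r>0$ set $$P(r)=(p-1)|v'(r)|^{p-2}r^{n-1},\qquad Q(r)=\mu\, r^{n-3}|v'(r)|^{p-2},\qquad w(r)=v(r)^{p^*-2}r^{n-1}.$$ Let $Y$ be the completion of $C_c^\infty([0,\infty))$ (smooth up to $0$, with no condition at $0$) in the norm $$\Big(\int_0^\infty f^2\,v^{p^*-2}r^{n-1}\,dr+\int_0^\infty (f')^2\,|v'|^{p-2}r^{n-1}\,dr\Big)^{1/2}.$$ An eigenfunction with eigenvalue $\alpha\in\mathbb R$ is a function $f\in Y$, not identically zero, such that $f$ and $Pf'$ are differentiable on $(0,\infty)$ and $$(Pf')'-Qf+\alpha w f=0\quad\text{on }(0,\infty).$$ Then every eigenfunction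 has a finite limit at $0$, hence extends continuously to $[0,\infty)$, and the following hold. 1. If $f_1$ and $f_2$ are eigenfunctions with the same eigenvalue $\alpha$, then $f_1=cf_2$ for some constant $c\in\mathbb R$. In other words, each eigenspace is one-dimensional. 2. The set of eigenvalues is $\{\alpha_1<\alpha_2<\alpha_3<\cdots\}$ for a strictly increasing sequence with $\alpha_i\to\infty$, and for every $i\ge 1$ each eigenfunction with eigenvalue $\alpha_i$ has exactly $i-1$ zeros in the open interval $(0,\infty)$. -/

import Mathlib

open Set Filter Topology MeasureTheory
open scoped ContDiff ENNReal

namespace RadialSL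

noncomputable section

/-- The Sobolev exponent `p* = n p / (n - p)`. -/
def pStar (n : ℕ) (p : ℝ) : ℝ := n * p / (n - p)

/-- The Hölder conjugate exponent `p' = p / (p - 1)`. -/
def pConj (p : ℝ) : ℝ := p / (p - 1)

/-- The profile `(1 + r ^ p') ^ (-(n - p) / p)` of the extremal function, not yet normalised. -/
def profile (n : ℕ) (p : ℝ) (r : ℝ) : ℝ :=
  (1 + r ^ pConj p) ^ (-((n - p) / p))

/-- The constant `κ₀ > 0` for which `x ↦ κ₀ * profile n p |x|` has `L^{p*}(ℝⁿ)` norm one. -/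
def kappa (n : ℕ) (p : ℝ) : ℝ :=
  (∫ x : EuclideanSpace ℝ (Fin n), profile n p ‖x‖ ^ pStar n p) ^ (-(1 / pStar n p))

/-- The radial part `v(r) = κ₀ (1 + r ^ p') ^ (-(n - p) / p)` of the extremal function
of the Sobolev inequality. -/
def v (n : ℕ) (p : ℝ) (r : ℝ) : ℝ := kappa n p * profile n p r

/-- The weight `|v'| ^ (p - 2) r ^ (n - 1)`. -/
def gradWeight (n : ℕ) (p : ℝ) (r : ℝ) : ℝ :=
  |deriv (v n p) r| ^ (p - 2) * r ^ (n - 1)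

/-- `P(r) = (p - 1) |v'| ^ (p - 2) r ^ (n - 1)`. -/
def P (n : ℕ) (p : ℝ) (r : ℝ) : ℝ :=
  (p - 1) * |deriv (v n p) r| ^ (p - 2) * r ^ (n - 1)

/-- `Q(r) = μ r ^ (n - 3) |v'| ^ (p - 2)`; in the theorem `n > p ≥ 2`, so that `n ≥ 3`. -/
def Q (n : ℕ) (p μ : ℝ) (r : ℝ) : ℝ :=
  μ * r ^ (n - 3) * |deriv (v n p) r| ^ (p - 2)

/-- `w(r) = v ^ (p* - 2) r ^ (n - 1)`. -/
def w (n : ℕ) (p : ℝ) (r : ℝ) : ℝ :=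
  v n p r ^ (pStar n p - 2) * r ^ (n - 1)

/-- The squared weighted norm `∫₀^∞ u² ω₀ + ∫₀^∞ g² ω₁` of a function `u` with derivative `g`. -/
def normSq (ω₀ ω₁ : ℝ → ℝ) (u g : ℝ → ℝ) : ℝ≥0∞ :=
  ∫⁻ r in Ioi (0 : ℝ), ENNReal.ofReal (u r ^ 2 * ω₀ r + g r ^ 2 * ω₁ r)

/-- The space `W₀^{1,2}([0,∞), ω₀, ω₁)`: the completion of `C_c^∞([0,∞))` (restrictions to
`[0,∞)` of smooth compactly supported functions on `ℝ`; no condition at `0`) in the weighted norm.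
Thus `f` belongs to it if `f` and some function `g` (which is then the weak derivative of `f`) are
the limits, in the weighted norm, of `φ k` and `(φ k)'` for a sequence of test functions `φ k`. -/
def MemW0 (ω₀ ω₁ : ℝ → ℝ) (f : ℝ → ℝ) : Prop :=
  AEMeasurable f (volume.restrict (Ioi (0 : ℝ))) ∧
  ∃ g : ℝ → ℝ, AEMeasurable g (volume.restrict (Ioi (0 : ℝ))) ∧
    ∃ φ : ℕ → ℝ → ℝ, (∀ k, ContDiff ℝ ∞ (φ k) ∧ HasCompactSupport (φ k)) ∧
      Tendsto (fun k => normSq ω₀ ω₁ (fun r => f r - φ k r) (fun r => g r - deriv (φ k) r))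
        atTop (𝓝 0)

/-- The space `Y = W₀^{1,2}([0,∞), v ^ (p* - 2) r ^ (n - 1), |v'| ^ (p - 2) r ^ (n - 1))`. -/
def MemY (n : ℕ) (p : ℝ) (f : ℝ → ℝ) : Prop :=
  MemW0 (w n p) (gradWeight n p) f

/-- `f` is an eigenfunction with eigenvalue `α` of `L f = ((P f')' - Q f) / w`: it is not
identically zero, belongs to `Y`, and satisfies `(P f')' - Q f + α w f = 0` on `(0,∞)`. Only the
values of `f` on `(0,∞)` matter. -/
structure IsEigenfunction (n : ℕ) (p μ α : ℝ) (f : ℝ → ℝ) : Prop where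
  nontrivial : ∃ r, 0 < r ∧ f r ≠ 0
  mem : MemY n p f
  differentiable : ∀ r, 0 < r → DifferentiableAt ℝ f r
  flux_differentiable : ∀ r, 0 < r → DifferentiableAt ℝ (fun s => P n p s * deriv f s) r
  equation : ∀ r, 0 < r →
    deriv (fun s => P n p s * deriv f s) r - Q n p μ r * f r + α * w n p r * f r = 0

/-- The eigenvalues of `L`. -/
def eigenvalues (n : ℕ) (p μ : ℝ) : Set ℝ :=
  {α | ∃ f : ℝ → ℝ, IsEigenfunction n p μ α f}

end

end RadialSL

/-!
# The radial Sturm–Liouville problem is a Jacobi problem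

In the variable `z = r ^ p' / (1 + r ^ p')`, which maps `(0,∞)` onto `(0,1)`, all the weights are
products of powers: with `β = n - n / p - 1` and `ε = (n - p) / p`, both positive,

* `|v'| ^ (p - 2) r ^ (n - 1) = K r z ^ β (1 - z) ^ (-ε)`,
* `v ^ (p* - 2) r ^ (n - 1) = N z ^ (β + 1) (1 - z) ^ (1 - ε) / r`

(`RadialSL.gradWeight_eq`, `RadialSL.w_eq`). The eigenvalue equation therefore has only the three
regular singular points `z = 0, 1, ∞`. Let `s ≥ 0` and `τ ≥ ε` be its larger exponents at `0` and
`1`. The substitution `f = z ^ s (1 - z) ^ τ J(z)` turns it into the Jacobi equation for `J`, which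
has a polynomial solution of each degree `k`, for an explicit eigenvalue that is increasing
and unbounded in `k` (`JacobiModel.isSol_psi`). Such an `f` lies in the energy space, by a
logarithmic cut-off (`JacobiModel.memW0_of_regularBound`).

There are no other eigenfunctions (`JacobiModel.exists_eq_psi`). A Hardy-type inequality shows that
every element of the energy space is `O(z ^ (-β / 2) (1 - z) ^ (ε / 2))`
(`JacobiModel.energyBound_of_memW0`). This growth bound suffices for the boundary terms in Green's
identity against the explicit eigenfunctions to vanish (`JacobiModel.green`), so an eigenfunction is
orthogonal to all of these with a different eigenvalue. Since the Jacobi polynomials span all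
polynomials, which are dense in the continuous functions on `[0,1]`, the explicit system is complete
(`JacobiModel.eq_zero_of_moments`), and an eigenfunction is a multiple of one of its members. In
particular eigenspaces are lines, and eigenfunctions have a limit at `0`.

The eigenfunction of degree `k` has exactly `k` zeros, since a polynomial of degree `k` that is
orthogonal to all polynomials of lower degree changes sign `k` times
(`JacobiModel.encard_zeros_psi`).
-/

namespace JacobiModel

noncomputable section

section

/-! ### The variable `z` and its power weights -/

/-- The variable `z = r ^ q / (1 + r ^ q)`, which maps `(0,∞)` increasingly onto `(0,1)`. -/
def zc (q r : ℝ) : ℝ := r ^ q / (1 + r ^ q)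

/-- The power weight `z ^ a * (1 - z) ^ b`, where `z = zc q r`. -/
def zp (q a b r : ℝ) : ℝ := zc q r ^ a * (1 - zc q r) ^ b

variable {q a b a' b' r : ℝ}

lemma one_sub_zc (hr : 0 < r) : 1 - zc q r = 1 / (1 + r ^ q) := by
  have : 0 < r ^ q := Real.rpow_pos_of_pos hr q
  unfold zc
  field_simp
  ring

lemma zc_pos (hr : 0 < r) : 0 < zc q r := by
  have : 0 < r ^ q := Real.rpow_pos_of_pos hr q
  unfold zc
  positivity

lemma one_sub_zc_pos (hr : 0 < r) : 0 < 1 - zc q r := by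
  have : 0 < r ^ q := Real.rpow_pos_of_pos hr q
  rw [one_sub_zc hr]
  positivity

lemma zc_lt_one (hr : 0 < r) : zc q r < 1 := by linarith [one_sub_zc_pos (q := q) hr]

lemma zc_mem_Icc (hr : 0 < r) : zc q r ∈ Icc (0 : ℝ) 1 := ⟨(zc_pos hr).le, (zc_lt_one hr).le⟩

lemma hasDerivAt_zc (hr : 0 < r) :
    HasDerivAt (zc q) (q * (zc q r * (1 - zc q r)) / r) r := by
  have h0 : 0 < r ^ q := Real.rpow_pos_of_pos hr q
  have h1 : HasDerivAt (fun r : ℝ => r ^ q) (q * r ^ (q - 1)) r :=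
    Real.hasDerivAt_rpow_const (Or.inl hr.ne')
  have h2 := h1.div (h1.const_add 1) (by positivity)
  refine h2.congr_deriv ?_
  rw [one_sub_zc hr, Real.rpow_sub_one hr.ne']
  unfold zc
  field_simp
  ring

lemma contDiffAt_zc (hr : 0 < r) : ContDiffAt ℝ ∞ (zc q) r := by
  have h0 : 0 < r ^ q := Real.rpow_pos_of_pos hr q
  have h1 : ContDiffAt ℝ ∞ (fun r : ℝ => r ^ q) r :=
    Real.contDiffAt_rpow_const_of_ne hr.ne'
  exact h1.div (contDiffAt_const.add h1) (by positivity)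

lemma zc_strictMonoOn (hq : 0 < q) : StrictMonoOn (zc q) (Ioi 0) := by
  intro x hx y hy hxy
  have h1 : x ^ q < y ^ q := Real.rpow_lt_rpow (le_of_lt hx) hxy hq
  have h2 : 0 < x ^ q := Real.rpow_pos_of_pos hx q
  have h3 : 0 < y ^ q := Real.rpow_pos_of_pos hy q
  unfold zc
  rw [div_lt_div_iff₀ (by positivity) (by positivity)]
  nlinarith

lemma exists_zc_eq (hq : 0 < q) {t : ℝ} (h0 : 0 < t) (h1 : t < 1) : ∃ r, 0 < r ∧ zc q r = t := by
  have h2 : 0 < t / (1 - t) := div_pos h0 (by linarith)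
  refine ⟨(t / (1 - t)) ^ (1 / q), Real.rpow_pos_of_pos h2 _, ?_⟩
  unfold zc
  rw [← Real.rpow_mul h2.le, one_div_mul_cancel hq.ne', Real.rpow_one]
  have : 1 - t ≠ 0 := by linarith
  field_simp
  ring

lemma tendsto_zc_zero (hq : 0 < q) : Tendsto (zc q) (𝓝[>] 0) (𝓝 0) := by
  have h1 : Tendsto (fun r : ℝ => r ^ q) (𝓝[>] 0) (𝓝 0) := by
    have := (Real.continuousAt_rpow_const 0 q (Or.inr hq.le)).tendsto
    rw [Real.zero_rpow hq.ne'] at this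
    exact this.mono_left nhdsWithin_le_nhds
  have h2 := h1.div (h1.const_add 1) (by norm_num)
  rw [zero_div] at h2
  exact h2

lemma tendsto_one_sub_zc_atTop (hq : 0 < q) : Tendsto (fun r => 1 - zc q r) atTop (𝓝 0) := by
  have h1 : Tendsto (fun r : ℝ => 1 / (1 + r ^ q)) atTop (𝓝 0) := by
    simp only [one_div]
    exact tendsto_inv_atTop_zero.comp (tendsto_atTop_add_const_left _ _ (tendsto_rpow_atTop hq))
  refine h1.congr' ?_
  filter_upwards [eventually_gt_atTop 0] with r hr
  rw [one_sub_zc hr]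

lemma zp_pos (hr : 0 < r) : 0 < zp q a b r :=
  mul_pos (Real.rpow_pos_of_pos (zc_pos hr) _) (Real.rpow_pos_of_pos (one_sub_zc_pos hr) _)

lemma zp_mul (hr : 0 < r) : zp q a b r * zp q a' b' r = zp q (a + a') (b + b') r := by
  unfold zp
  rw [Real.rpow_add (zc_pos hr), Real.rpow_add (one_sub_zc_pos hr)]
  ring

lemma zp_sq (hr : 0 < r) : zp q a b r ^ 2 = zp q (2 * a) (2 * b) r := by
  rw [sq, zp_mul hr, two_mul, two_mul]

lemma zp_one_one : zp q 1 1 r = zc q r * (1 - zc q r) := by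
  simp [zp]

lemma zp_le_one (hr : 0 < r) (ha : 0 ≤ a) (hb : 0 ≤ b) : zp q a b r ≤ 1 := by
  unfold zp
  have h1 : zc q r ^ a ≤ 1 := Real.rpow_le_one (zc_pos hr).le (zc_lt_one hr).le ha
  have h2 : (1 - zc q r) ^ b ≤ 1 :=
    Real.rpow_le_one (one_sub_zc_pos hr).le (by linarith [zc_pos (q := q) hr]) hb
  exact mul_le_one₀ h1 (Real.rpow_nonneg (one_sub_zc_pos hr).le _) h2

lemma zp_le_zp (hr : 0 < r) (ha : a' ≤ a) (hb : b' ≤ b) : zp q a b r ≤ zp q a' b' r := by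
  have := zp_mul (q := q) (a := a') (b := b') (a' := a - a') (b' := b - b') hr
  rw [add_sub_cancel, add_sub_cancel] at this
  rw [← this]
  exact mul_le_of_le_one_right (zp_pos hr).le (zp_le_one hr (by linarith) (by linarith))

lemma hasDerivAt_zp (hr : 0 < r) :
    HasDerivAt (zp q a b) (q / r * (a * (1 - zc q r) - b * zc q r) * zp q a b r) r := by
  have hz := zc_pos (q := q) hr
  have hz' := one_sub_zc_pos (q := q) hr
  have h := hasDerivAt_zc (q := q) hr
  have h1 := h.rpow_const (p := a) (Or.inl hz.ne')
  have h2 := (h.const_sub 1).rpow_const (p := b) (Or.inl hz'.ne')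
  refine (h1.mul h2).congr_deriv ?_
  unfold zp
  rw [Real.rpow_sub_one hz.ne', Real.rpow_sub_one hz'.ne']
  field_simp
  ring

lemma contDiffAt_zp (hr : 0 < r) : ContDiffAt ℝ ∞ (zp q a b) r := by
  have h := contDiffAt_zc (q := q) hr
  exact (h.rpow_const_of_ne (zc_pos hr).ne').mul
    ((contDiffAt_const.sub h).rpow_const_of_ne (one_sub_zc_pos hr).ne')

lemma continuousOn_zc : ContinuousOn (zc q) (Ioi 0) :=
  fun _ hr => (contDiffAt_zc hr).continuousAt.continuousWithinAt

lemma continuousOn_zp : ContinuousOn (zp q a b) (Ioi 0) :=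
  fun _ hr => (contDiffAt_zp hr).continuousAt.continuousWithinAt

lemma zp_le_left (hr : 0 < r) (hb : 0 ≤ b) : zp q a b r ≤ zc q r ^ a := by
  have h2 : (1 - zc q r) ^ b ≤ 1 :=
    Real.rpow_le_one (one_sub_zc_pos hr).le (by linarith [zc_pos (q := q) hr]) hb
  exact mul_le_of_le_one_right (Real.rpow_nonneg (zc_pos hr).le _) h2

lemma zp_le_right (hr : 0 < r) (ha : 0 ≤ a) : zp q a b r ≤ (1 - zc q r) ^ b := by
  have h1 : zc q r ^ a ≤ 1 := Real.rpow_le_one (zc_pos hr).le (zc_lt_one hr).le ha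
  exact mul_le_of_le_one_left (Real.rpow_nonneg (one_sub_zc_pos hr).le _) h1

lemma tendsto_zp_zero (hq : 0 < q) (ha : 0 < a) (hb : 0 ≤ b) :
    Tendsto (zp q a b) (𝓝[>] 0) (𝓝 0) := by
  have h1 : Tendsto (fun r => zc q r ^ a) (𝓝[>] 0) (𝓝 0) := by
    have := (tendsto_zc_zero hq).rpow_const (p := a) (Or.inr ha.le)
    rwa [Real.zero_rpow ha.ne'] at this
  refine squeeze_zero' ?_ ?_ h1
  · filter_upwards [self_mem_nhdsWithin] with r hr using (zp_pos hr).le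
  · filter_upwards [self_mem_nhdsWithin] with r hr using zp_le_left hr hb

lemma tendsto_zp_atTop (hq : 0 < q) (ha : 0 ≤ a) (hb : 0 < b) :
    Tendsto (zp q a b) atTop (𝓝 0) := by
  have h1 : Tendsto (fun r => (1 - zc q r) ^ b) atTop (𝓝 0) := by
    have := (tendsto_one_sub_zc_atTop hq).rpow_const (p := b) (Or.inr hb.le)
    rwa [Real.zero_rpow hb.ne'] at this
  refine squeeze_zero' ?_ ?_ h1
  · filter_upwards [eventually_gt_atTop 0] with r hr using (zp_pos hr).le
  · filter_upwards [eventually_gt_atTop 0] with r hr using zp_le_right hr ha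

lemma integrableOn_Ioi_of_hasDerivAt_nonneg {F F' : ℝ → ℝ} {A l : ℝ}
    (hF : ∀ r, 0 < r → HasDerivAt F (F' r) r) (hpos : ∀ r, 0 < r → 0 ≤ F' r)
    (h0 : Tendsto F (𝓝[>] 0) (𝓝 A)) (hl : Tendsto F atTop (𝓝 l)) :
    IntegrableOn F' (Ioi 0) := by
  -- the primitive is extended continuously to the endpoint
  have hev : ∀ r : ℝ, 0 < r → Function.update F 0 A =ᶠ[𝓝 r] F := fun r hr => by
    filter_upwards [Ioi_mem_nhds hr] with s hs
    exact Function.update_of_ne (ne_of_gt hs) _ _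
  refine integrableOn_Ioi_deriv_of_nonneg (g := Function.update F 0 A) (l := l) ?_
    (fun r hr => (hF r hr).congr_of_eventuallyEq (hev r hr)) (fun r hr => hpos r hr) ?_
  · rw [ContinuousWithinAt, Function.update_self]
    have : Tendsto (Function.update F 0 A) (𝓝[>] 0) (𝓝 A) := by
      refine h0.congr' ?_
      filter_upwards [self_mem_nhdsWithin] with s hs
      exact (Function.update_of_ne (ne_of_gt hs) _ _).symm
    have h2 : ContinuousWithinAt (Function.update F 0 A) (Ioi 0) 0 := by
      rw [ContinuousWithinAt, Function.update_self]; exact this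
    have h3 := (continuousWithinAt_Ioi_iff_Ici).1 h2
    rw [ContinuousWithinAt, Function.update_self] at h3
    exact h3
  · refine hl.congr' ?_
    filter_upwards [eventually_gt_atTop 0] with s hs
    exact (Function.update_of_ne (ne_of_gt hs) _ _).symm

/-- The Beta integral converges, in the variable `r`: `dz = q z (1 - z) dr / r`. -/
lemma integrableOn_zp_div (hq : 0 < q) (ha : 0 < a) (hb : 0 < b) :
    IntegrableOn (fun r => zp q a b r / r) (Ioi 0) := by
  have z1 : Tendsto (fun r => 1 - zc q r) (𝓝[>] 0) (𝓝 1) := by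
    simpa using (tendsto_zc_zero hq).const_sub 1
  have z2 : Tendsto (zc q) atTop (𝓝 1) := by
    simpa using (tendsto_one_sub_zc_atTop hq).const_sub 1
  have i1 : IntegrableOn (fun r => q / r * (a * (1 - zc q r)) * zc q r ^ a) (Ioi 0) := by
    refine integrableOn_Ioi_of_hasDerivAt_nonneg (F := fun r => zc q r ^ a) (fun r hr => ?_)
      (fun r hr => ?_) ((tendsto_zc_zero hq).rpow_const (Or.inr ha.le))
      (z2.rpow_const (Or.inr ha.le))
    · have := hasDerivAt_zp (q := q) (a := a) (b := 0) hr
      have e : zp q a 0 = fun r => zc q r ^ a := by ext s; simp [zp]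
      rw [e] at this
      simpa using this
    · have := zc_pos (q := q) hr
      have := one_sub_zc_pos (q := q) hr
      positivity
  have i2 : IntegrableOn (fun r => q / r * (b * zc q r) * (1 - zc q r) ^ b) (Ioi 0) := by
    refine integrableOn_Ioi_of_hasDerivAt_nonneg (F := fun r => -(1 - zc q r) ^ b)
      (fun r hr => ?_) (fun r hr => ?_) (z1.rpow_const (Or.inr hb.le)).neg
      ((tendsto_one_sub_zc_atTop hq).rpow_const (Or.inr hb.le)).neg
    · have := (hasDerivAt_zp (q := q) (a := 0) (b := b) hr).neg
      have e : -zp q 0 b = fun r => -(1 - zc q r) ^ b := by ext s; simp [zp]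
      rw [e] at this
      refine this.congr_deriv ?_
      simp [zp]
    · have := zc_pos (q := q) hr
      have := one_sub_zc_pos (q := q) hr
      positivity
  refine Integrable.mono' ((i1.const_mul (1 / (q * a))).add (i2.const_mul (1 / (q * b)))) ?_ ?_
  · exact ((continuousOn_zp.div continuousOn_id (fun r hr => ne_of_gt hr)).aestronglyMeasurable
      measurableSet_Ioi)
  · filter_upwards [ae_restrict_mem measurableSet_Ioi] with r hr
    have hr : 0 < r := hr
    have h1 := zc_pos (q := q) hr
    have h2 := one_sub_zc_pos (q := q) hr
    have h3 := zp_le_left (q := q) (a := a) hr hb.le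
    have h4 := zp_le_right (q := q) (b := b) hr ha.le
    rw [Real.norm_of_nonneg (div_nonneg (zp_pos hr).le hr.le)]
    have e : zp q a b r / r
        = (zp q a b r * (1 - zc q r) + zp q a b r * zc q r) / r := by ring
    have e2 : 1 / (q * a) * (q / r * (a * (1 - zc q r)) * zc q r ^ a)
        + 1 / (q * b) * (q / r * (b * zc q r) * (1 - zc q r) ^ b)
        = (zc q r ^ a * (1 - zc q r) + (1 - zc q r) ^ b * zc q r) / r := by
      field_simp
    simp only [Pi.add_apply]
    rw [e, e2]
    gcongr

/-- Doubling the radius changes `z ^ (-a) * (1 - z) ^ b` by at most a constant factor. -/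
lemma zp_neg_le_of_le_two_mul (hq : 0 < q) (ha : 0 ≤ a) (hb : 0 ≤ b) {x y : ℝ} (hx : 0 < x)
    (hy : 0 < y) (hyx : y ≤ 2 * x) :
    zp q (-a) b x ≤ (2 ^ q) ^ (a + b) * zp q (-a) b y := by
  have hxq : 0 < x ^ q := Real.rpow_pos_of_pos hx q
  have hyq : 0 < y ^ q := Real.rpow_pos_of_pos hy q
  have h2q : (1 : ℝ) ≤ 2 ^ q := Real.one_le_rpow (by norm_num) hq.le
  have hle : y ^ q ≤ 2 ^ q * x ^ q := by
    rw [← Real.mul_rpow (by norm_num) hx.le]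
    exact Real.rpow_le_rpow hy.le hyx hq.le
  have h1 : zc q y ≤ 2 ^ q * zc q x := by
    unfold zc
    rw [mul_div_assoc', div_le_div_iff₀ (by positivity) (by positivity)]
    nlinarith [mul_pos hxq hyq]
  have h2 : 1 - zc q x ≤ 2 ^ q * (1 - zc q y) := by
    rw [one_sub_zc hx, one_sub_zc hy, mul_one_div, div_le_div_iff₀ (by positivity) (by positivity)]
    nlinarith [mul_pos hxq hyq]
  have h2p : (0 : ℝ) < 2 ^ q := by positivity
  have zx := zc_pos (q := q) hx
  have zy := zc_pos (q := q) hy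
  have zx' := one_sub_zc_pos (q := q) hx
  have zy' := one_sub_zc_pos (q := q) hy
  have h3 : zc q x ^ (-a) ≤ (2 ^ q) ^ a * zc q y ^ (-a) := by
    have := Real.rpow_le_rpow zy.le h1 ha
    rw [Real.mul_rpow h2p.le zx.le] at this
    rw [Real.rpow_neg zx.le, Real.rpow_neg zy.le]
    have p1 : 0 < zc q x ^ a := Real.rpow_pos_of_pos zx _
    have p2 : 0 < zc q y ^ a := Real.rpow_pos_of_pos zy _
    rw [inv_eq_one_div, ← div_eq_mul_inv, div_le_div_iff₀ p1 p2]
    linarith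
  have h4 : (1 - zc q x) ^ b ≤ (2 ^ q) ^ b * (1 - zc q y) ^ b := by
    have := Real.rpow_le_rpow zx'.le h2 hb
    rwa [Real.mul_rpow h2p.le zy'.le] at this
  unfold zp
  rw [Real.rpow_add h2p]
  calc zc q x ^ (-a) * (1 - zc q x) ^ b
      ≤ ((2 ^ q) ^ a * zc q y ^ (-a)) * ((2 ^ q) ^ b * (1 - zc q y) ^ b) := by
        gcongr
    _ = _ := by ring

end

section

/-! ### Jacobi polynomials -/

open Polynomial

/-- The coefficients of the hypergeometric series solving the Jacobi equation
`z (1 - z) J'' + (A + 1 - (A + B + 2) z) J' + k (k + A + B + 1) J = 0` with `J 0 = 1`. -/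
def jacCoeff (A B : ℝ) (k : ℕ) : ℕ → ℝ
  | 0 => 1
  | j + 1 => (j * (j + A + B + 1) - k * (k + A + B + 1)) / ((j + 1) * (j + 1 + A)) *
      jacCoeff A B k j

/-- The Jacobi polynomial of degree `k` on `(0,1)` for the weight `z ^ A * (1 - z) ^ B`,
normalised by `J 0 = 1`. -/
def jac (A B : ℝ) (k : ℕ) : ℝ[X] :=
  ∑ j ∈ Finset.range (k + 1), monomial j (jacCoeff A B k j)

variable {A B : ℝ} {k : ℕ}

lemma jacCoeff_eq_zero {j : ℕ} (hj : k < j) : jacCoeff A B k j = 0 := by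
  induction j with
  | zero => omega
  | succ j ih =>
    rcases Nat.lt_succ_iff_lt_or_eq.1 hj with h | h
    · rw [jacCoeff, ih h, mul_zero]
    · subst h
      simp [jacCoeff]

lemma jacCoeff_ne_zero (hA : 0 ≤ A) (hB : 0 ≤ B) {j : ℕ} (hj : j ≤ k) :
    jacCoeff A B k j ≠ 0 := by
  induction j with
  | zero => simp [jacCoeff]
  | succ j ih =>
    have h1 : (j : ℝ) < k := by exact_mod_cast hj
    have h2 : (0 : ℝ) ≤ j := by positivity
    rw [jacCoeff]
    refine mul_ne_zero (div_ne_zero ?_ (by positivity)) (ih (by omega))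
    nlinarith

lemma coeff_jac (j : ℕ) : (jac A B k).coeff j = jacCoeff A B k j := by
  rw [jac, finsetSum_coeff]
  simp only [coeff_monomial, Finset.sum_ite_eq', Finset.mem_range]
  split_ifs with h
  · rfl
  · exact (jacCoeff_eq_zero (by omega)).symm

lemma eval_zero_jac : (jac A B k).eval 0 = 1 := by
  rw [← coeff_zero_eq_eval_zero, coeff_jac, jacCoeff]

lemma degree_jac (hA : 0 ≤ A) (hB : 0 ≤ B) : (jac A B k).degree = k := by
  refine le_antisymm ((degree_le_iff_coeff_zero _ _).2 fun m hm => ?_) (le_degree_of_ne_zero ?_)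
  · rw [coeff_jac]
    exact jacCoeff_eq_zero (by exact_mod_cast hm)
  · rw [coeff_jac]
    exact jacCoeff_ne_zero hA hB le_rfl

/-- The Jacobi polynomials, as a sequence with one polynomial in each degree. -/
def jacSeq (A B : ℝ) (hA : 0 ≤ A) (hB : 0 ≤ B) : Polynomial.Sequence ℝ where
  elems' := jac A B
  degree_eq' _ := degree_jac hA hB

lemma isUnit_leadingCoeff_jacSeq (hA : 0 ≤ A) (hB : 0 ≤ B) (k : ℕ) :
    IsUnit (jacSeq A B hA hB k).leadingCoeff :=
  (leadingCoeff_ne_zero.2 ((jacSeq A B hA hB).ne_zero k)).isUnit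

lemma span_jac (hA : 0 ≤ A) (hB : 0 ≤ B) : Submodule.span ℝ (range (jac A B)) = ⊤ :=
  (jacSeq A B hA hB).span (isUnit_leadingCoeff_jacSeq hA hB)

lemma span_jac_lt (hA : 0 ≤ A) (hB : 0 ≤ B) :
    Submodule.span ℝ (jac A B '' Iio k) = degreeLT ℝ k :=
  (jacSeq A B hA hB).span_degreeLT (fun i _ => isUnit_leadingCoeff_jacSeq hA hB i)

lemma jac_ode_polynomial (hA : 0 ≤ A) :
    X * derivative (derivative (jac A B k)) - X * (X * derivative (derivative (jac A B k)))
      + C (A + 1) * derivative (jac A B k) - C (A + B + 2) * (X * derivative (jac A B k))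
      + C (k * (k + A + B + 1)) * jac A B k = 0 := by
  have hrec : ∀ j : ℕ, ((j : ℝ) + 1) * (j + 1 + A) * jacCoeff A B k (j + 1)
      = (j * (j + A + B + 1) - k * (k + A + B + 1)) * jacCoeff A B k j := fun j => by
    rw [jacCoeff]
    field_simp
  ext j
  rcases j with _ | _ | j
  · have := hrec 0
    simp only [coeff_add, coeff_sub, coeff_C_zero, mul_coeff_zero, coeff_X_zero, coeff_derivative,
      coeff_jac, coeff_zero] at this ⊢
    push_cast at this ⊢
    linear_combination this
  · have := hrec 1
    simp only [coeff_add, coeff_sub, coeff_C_mul, coeff_X_mul, mul_coeff_zero, coeff_X_zero,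
      coeff_derivative, coeff_jac, coeff_zero] at this ⊢
    push_cast at this ⊢
    linear_combination this
  · have := hrec (j + 2)
    simp only [coeff_add, coeff_sub, coeff_C_mul, coeff_X_mul, coeff_derivative,
      coeff_jac, coeff_zero] at this ⊢
    push_cast at this ⊢
    linear_combination this

lemma jac_ode (hA : 0 ≤ A) (z : ℝ) :
    z * (1 - z) * (derivative (derivative (jac A B k))).eval z
      + (A + 1 - (A + B + 2) * z) * (derivative (jac A B k)).eval z
      + k * (k + A + B + 1) * (jac A B k).eval z = 0 := by
  have := congrArg (eval z) (jac_ode_polynomial (A := A) (B := B) (k := k) hA)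
  simp only [eval_add, eval_sub, eval_mul, eval_X, eval_C, eval_zero] at this
  linear_combination this

/-- Multiplying a polynomial by `X - z` for each of its roots `z` of odd multiplicity in an
interval leaves no sign change there. -/
lemma exists_mul_prod_eq_sq_mul (s : Set ℝ) (p : ℝ[X]) (hp : p ≠ 0) :
    ∃ (S : Finset ℝ) (R T : ℝ[X]), (∀ z ∈ S, z ∈ s ∧ p.eval z = 0) ∧
      p * ∏ z ∈ S, (X - C z) = R ^ 2 * T ∧ ∀ z ∈ s, T.eval z ≠ 0 := by
  classical
  induction hd : p.natDegree generalizing p with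
  | zero =>
    refine ⟨∅, 1, p, by simp, by simp, fun z _ h => hp ?_⟩
    rw [eq_C_of_natDegree_eq_zero hd] at h ⊢
    simp only [eval_C] at h
    rw [h, C_0]
  | succ d ih =>
    by_cases hroot : ∃ z ∈ s, p.eval z = 0
    · obtain ⟨z, hz, hz0⟩ := hroot
      obtain ⟨p₁, rfl⟩ := dvd_iff_isRoot.2 hz0
      have hp₁ : p₁ ≠ 0 := right_ne_zero_of_mul hp
      have hd₁ : p₁.natDegree = d := by
        rw [natDegree_mul (X_sub_C_ne_zero z) hp₁, natDegree_X_sub_C] at hd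
        omega
      obtain ⟨S, R, T, hS, hRT, hT⟩ := ih p₁ hp₁ hd₁
      by_cases hzS : z ∈ S
      · refine ⟨S.erase z, R, T, fun y hy => ?_, ?_, hT⟩
        · obtain ⟨h1, h2⟩ := hS y (Finset.mem_of_mem_erase hy)
          exact ⟨h1, by rw [eval_mul, h2, mul_zero]⟩
        · rw [← hRT, ← Finset.mul_prod_erase S _ hzS]
          ring
      · refine ⟨insert z S, (X - C z) * R, T, fun y hy => ?_, ?_, hT⟩
        · rcases Finset.mem_insert.1 hy with rfl | hy
          · exact ⟨hz, hz0⟩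
          · obtain ⟨h1, h2⟩ := hS y hy
            exact ⟨h1, by rw [eval_mul, h2, mul_zero]⟩
        · rw [Finset.prod_insert hzS]
          linear_combination (X - C z) ^ 2 * hRT
    · exact ⟨∅, 1, p, by simp, by simp, fun z hz h => hroot ⟨z, hz, h⟩⟩

/-- For a nonzero polynomial, some product of factors `X - z` over distinct roots in `(0,1)`
makes it of one sign on `(0,1)`. -/
lemma exists_prod_mul_nonneg (p : ℝ[X]) (hp : p ≠ 0) :
    ∃ (S : Finset ℝ) (e : ℝ), (∀ z ∈ S, z ∈ Ioo (0 : ℝ) 1 ∧ p.eval z = 0) ∧ e ≠ 0 ∧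
      ∀ z ∈ Ioo (0 : ℝ) 1, 0 ≤ e * (p * ∏ y ∈ S, (X - C y)).eval z := by
  obtain ⟨S, R, T, hS, hRT, hT⟩ := exists_mul_prod_eq_sq_mul (Ioo (0 : ℝ) 1) p hp
  have hhalf : (1 / 2 : ℝ) ∈ Ioo (0 : ℝ) 1 := by constructor <;> norm_num
  refine ⟨S, T.eval (1 / 2), hS, hT _ hhalf, fun z hz => ?_⟩
  have key : 0 ≤ T.eval (1 / 2) * T.eval z := by
    by_contra hneg
    have h0 : (0 : ℝ) ∈ (fun y => T.eval y) '' Ioo (0 : ℝ) 1 := by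
      have hc : IsPreconnected ((fun y => T.eval y) '' Ioo (0 : ℝ) 1) :=
        isPreconnected_Ioo.image _ T.continuous.continuousOn
      rcases mul_neg_iff.1 (not_le.1 hneg) with ⟨h1, h2⟩ | ⟨h1, h2⟩
      · exact hc.Icc_subset ⟨z, hz, rfl⟩ ⟨1 / 2, hhalf, rfl⟩ ⟨h2.le, h1.le⟩
      · exact hc.Icc_subset ⟨1 / 2, hhalf, rfl⟩ ⟨z, hz, rfl⟩ ⟨h1.le, h2.le⟩
    obtain ⟨y, hy, hy0⟩ := h0
    exact hT y hy hy0
  rw [hRT, eval_mul, eval_pow]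
  have := mul_nonneg (sq_nonneg (R.eval z)) key
  linarith

end

section

open Polynomial

/-! ### Integrals over the half-line -/

/-- The fundamental theorem of calculus on `(0,∞)` when the primitive vanishes along one sequence
tending to each end. -/
lemma integral_Ioi_eq_zero_of_tendsto_seq {F F' : ℝ → ℝ} {x y : ℕ → ℝ}
    (hF : ∀ r, 0 < r → HasDerivAt F (F' r) r) (hint : IntegrableOn F' (Ioi 0))
    (hx : ∀ n, 0 < x n) (hx0 : Tendsto x atTop (𝓝 0)) (hy : Tendsto y atTop atTop)
    (hFx : Tendsto (fun n => F (x n)) atTop (𝓝 0)) (hFy : Tendsto (fun n => F (y n)) atTop (𝓝 0)) :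
    ∫ r in Ioi (0 : ℝ), F' r = 0 := by
  have hcover : AECover (volume.restrict (Ioi (0 : ℝ))) atTop (fun n => Ioc (x n) (y n)) := by
    refine ⟨?_, fun n => measurableSet_Ioc⟩
    filter_upwards [ae_restrict_mem measurableSet_Ioi] with r hr
    filter_upwards [hx0.eventually_lt_const hr, hy.eventually_ge_atTop r] with n h1 h2
    exact ⟨h1, h2⟩
  have h1 := hcover.integral_tendsto_of_countably_generated hint
  refine tendsto_nhds_unique h1 ?_
  have h2 := hFy.sub hFx
  rw [sub_zero] at h2
  refine h2.congr' ?_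
  filter_upwards [hx0.eventually_lt_const one_pos, hy.eventually_ge_atTop 1] with n hn1 hn2
  have hxy : x n ≤ y n := hn1.le.trans hn2
  have hsub : Ioc (x n) (y n) ⊆ Ioi 0 := fun r hr => (hx n).trans hr.1
  rw [Measure.restrict_restrict measurableSet_Ioc, inter_eq_self_of_subset_left hsub,
    ← intervalIntegral.integral_of_le hxy]
  refine (intervalIntegral.integral_eq_sub_of_hasDerivAt (fun r hr => hF r ?_) ?_).symm
  · rw [uIcc_of_le hxy] at hr
    exact (hx n).trans_le hr.1
  · rw [intervalIntegrable_iff_integrableOn_Ioc_of_le hxy]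
    exact hint.mono_set hsub

lemma eq_zero_of_integral_eq_zero {h : ℝ → ℝ} (hc : ContinuousOn h (Ioi 0))
    (hint : IntegrableOn h (Ioi 0)) (hpos : ∀ r, 0 < r → 0 ≤ h r)
    (h0 : ∫ r in Ioi (0 : ℝ), h r = 0) : ∀ r, 0 < r → h r = 0 := by
  have hae : 0 ≤ᵐ[volume.restrict (Ioi 0)] h := by
    filter_upwards [ae_restrict_mem measurableSet_Ioi] with r hr using hpos r hr
  have h1 := (setIntegral_eq_zero_iff_of_nonneg_ae hae hint).1 h0
  exact fun r hr => Measure.eqOn_open_of_ae_eq h1 isOpen_Ioi hc continuousOn_const hr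

variable {q β ε m l a b s τ : ℝ} {f g h : ℝ → ℝ}

lemma continuousOn_eval_zc (p : ℝ[X]) : ContinuousOn (fun r => p.eval (zc q r)) (Ioi 0) :=
  p.continuous.comp_continuousOn continuousOn_zc

lemma exists_bound_eval (p : ℝ[X]) : ∃ M, 0 < M ∧ ∀ z ∈ Icc (0 : ℝ) 1, |p.eval z| ≤ M := by
  obtain ⟨M, hM⟩ := isCompact_Icc.exists_bound_of_continuousOn (s := Icc (0 : ℝ) 1)
    p.continuous.continuousOn
  exact ⟨max M 1, by positivity, fun z hz => (hM z hz).trans (le_max_left _ _)⟩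

lemma integrableOn_mul_comp_zc (hint : IntegrableOn h (Ioi 0)) {χ : ℝ → ℝ} (hχ : Continuous χ) :
    IntegrableOn (fun r => h r * χ (zc q r)) (Ioi 0) := by
  obtain ⟨M, hM⟩ := isCompact_Icc.exists_bound_of_continuousOn (s := Icc (0 : ℝ) 1)
    hχ.continuousOn
  refine Integrable.mul_bdd (c := M) hint
    ((hχ.comp_continuousOn continuousOn_zc).aestronglyMeasurable measurableSet_Ioi) ?_
  filter_upwards [ae_restrict_mem measurableSet_Ioi] with r hr using hM _ (zc_mem_Icc hr)

lemma integral_mul_eval_eq_zero_of_mem_span (hint : IntegrableOn h (Ioi 0)) {S : Set ℝ[X]}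
    (hS : ∀ p ∈ S, ∫ r in Ioi (0 : ℝ), h r * p.eval (zc q r) = 0) {p : ℝ[X]}
    (hp : p ∈ Submodule.span ℝ S) : ∫ r in Ioi (0 : ℝ), h r * p.eval (zc q r) = 0 := by
  induction hp using Submodule.span_induction with
  | mem p hp => exact hS p hp
  | zero => simp
  | add p₁ p₂ _ _ h₁ h₂ =>
    simp only [eval_add, mul_add]
    rw [integral_add (integrableOn_mul_comp_zc hint p₁.continuous)
      (integrableOn_mul_comp_zc hint p₂.continuous), h₁, h₂, add_zero]
  | smul c p _ h₁ =>
    simp only [eval_smul, smul_eq_mul, mul_left_comm _ c]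
    rw [integral_const_mul, h₁, mul_zero]

/-- A continuous integrable function whose moments with respect to `z` all vanish is zero:
by Weierstrass approximation it is orthogonal to every continuous function of `z`. -/
lemma eq_zero_of_moments (hq : 0 < q) (hc : ContinuousOn h (Ioi 0)) (hint : IntegrableOn h (Ioi 0))
    (h0 : ∀ p : ℝ[X], ∫ r in Ioi (0 : ℝ), h r * p.eval (zc q r) = 0) :
    ∀ r, 0 < r → h r = 0 := by
  have key : ∀ χ : ℝ → ℝ, Continuous χ → ∫ r in Ioi (0 : ℝ), h r * χ (zc q r) = 0 := by
    intro χ hχ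
    by_contra hne
    set I := ∫ r in Ioi (0 : ℝ), h r * χ (zc q r)
    set N := ∫ r in Ioi (0 : ℝ), |h r|
    have hN : 0 ≤ N := integral_nonneg fun r => abs_nonneg _
    have hη : 0 < |I| / (N + 1) := div_pos (abs_pos.2 hne) (by linarith)
    obtain ⟨p, hp⟩ := exists_polynomial_near_of_continuousOn 0 1 χ hχ.continuousOn _ hη
    have e1 : I = ∫ r in Ioi (0 : ℝ), h r * (χ (zc q r) - p.eval (zc q r)) := by
      simp only [mul_sub]
      rw [integral_sub (integrableOn_mul_comp_zc hint hχ)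
        (integrableOn_mul_comp_zc hint p.continuous), h0 p, sub_zero]
    have e2 : |I| ≤ ∫ r in Ioi (0 : ℝ), |h r| * (|I| / (N + 1)) := by
      conv_lhs => rw [e1]
      rw [← Real.norm_eq_abs]
      refine norm_integral_le_of_norm_le (Integrable.mul_const hint.norm _) ?_
      filter_upwards [ae_restrict_mem measurableSet_Ioi] with r hr
      rw [norm_mul, Real.norm_eq_abs, Real.norm_eq_abs, abs_sub_comm (χ _)]
      exact mul_le_mul_of_nonneg_left (hp _ (zc_mem_Icc hr)).le (abs_nonneg _)
    rw [integral_mul_const] at e2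
    have e3 : N * (|I| / (N + 1)) < |I| := by
      rw [mul_div_assoc', div_lt_iff₀ (by linarith)]
      nlinarith [abs_pos.2 hne]
    exact absurd e2 (not_le.2 e3)
  intro r₀ hr₀
  by_contra hne
  have hr₀ : 0 < r₀ := hr₀
  -- near `r₀` the function keeps its sign
  have hpos : ∀ᶠ r in 𝓝 r₀, 0 < h r₀ * h r := by
    have h1 : Tendsto (fun r => h r₀ * h r) (𝓝 r₀) (𝓝 (h r₀ * h r₀)) :=
      (hc.continuousAt (Ioi_mem_nhds hr₀)).tendsto.const_mul _
    exact h1.eventually_const_lt (mul_self_pos.2 hne)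
  obtain ⟨r₁, r₂, hr, hsub⟩ := mem_nhds_iff_exists_Ioo_subset.1
    (Filter.inter_mem hpos (Ioi_mem_nhds (half_lt_self hr₀)))
  set x₁ := max r₁ (r₀ / 2)
  have hx₁ : 0 < x₁ := lt_max_of_lt_right (half_pos hr₀)
  have hx₁r : x₁ < r₀ := max_lt hr.1 (by linarith)
  have hmono := zc_strictMonoOn hq
  set d := min (zc q r₀ - zc q x₁) (zc q r₂ - zc q r₀)
  have hd : 0 < d := lt_min (sub_pos.2 (hmono hx₁ hr₀ hx₁r))
    (sub_pos.2 (hmono hr₀ (hr₀.trans hr.2) hr.2))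
  let χ : ℝ → ℝ := fun t => max 0 (d - |t - zc q r₀|)
  have hχ : Continuous χ := by fun_prop
  have hint' := (integrableOn_mul_comp_zc (q := q) hint hχ).const_mul (h r₀)
  have hzero := eq_zero_of_integral_eq_zero
    (h := fun r => h r₀ * (h r * χ (zc q r)))
    (continuousOn_const.mul (hc.mul (hχ.comp_continuousOn continuousOn_zc))) hint' ?_ ?_ r₀ hr₀
  · simp only [χ, sub_self, abs_zero, sub_zero, max_eq_right hd.le] at hzero
    exact mul_ne_zero hne (mul_ne_zero hne hd.ne') hzero
  · intro r hr'
    rcases le_or_gt d |zc q r - zc q r₀| with hle | hlt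
    · simp [χ, max_eq_left (sub_nonpos.2 hle)]
    · have h1 := abs_lt.1 hlt
      have h2 : x₁ < r := by
        refine (hmono.lt_iff_lt hx₁ hr').1 ?_
        linarith [min_le_left (zc q r₀ - zc q x₁) (zc q r₂ - zc q r₀)]
      have h3 : r < r₂ := by
        refine (hmono.lt_iff_lt hr' (hr₀.trans hr.2)).1 ?_
        linarith [min_le_right (zc q r₀ - zc q x₁) (zc q r₂ - zc q r₀)]
      have h4 : 0 < h r₀ * h r := (hsub ⟨(le_max_left _ _).trans_lt h2, h3⟩).1
      rw [← mul_assoc]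
      exact mul_nonneg h4.le (le_max_left _ _)
  · rw [integral_const_mul, key χ hχ, mul_zero]

/-! ### The equation in the variable `z` -/

/-- The Sturm–Liouville equation `(G f')' = (q ^ 2 / r ^ 2) * (m - l z (1 - z)) * G f` on `(0,∞)`,
with `G = r z ^ β (1 - z) ^ (-ε)`. -/
def IsSol (q β ε m l : ℝ) (f : ℝ → ℝ) : Prop :=
  ∀ r, 0 < r → DifferentiableAt ℝ f r ∧
    HasDerivAt (fun s => s * zp q β (-ε) s * deriv f s)
      (q ^ 2 * (m - l * zp q 1 1 r) * zp q β (-ε) r / r * f r) r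

lemma IsSol.continuousOn (hf : IsSol q β ε m l f) : ContinuousOn f (Ioi 0) :=
  fun r hr => (hf r hr).1.continuousAt.continuousWithinAt

/-- The function `z ^ s * (1 - z) ^ τ * p z` of `r`. -/
def zpoly (q s τ : ℝ) (p : ℝ[X]) (r : ℝ) : ℝ := zp q s τ r * p.eval (zc q r)

/-- The operator on polynomials that corresponds to `z (1 - z) d/dz = (r / q) d/dr`, conjugated by
`z ^ s * (1 - z) ^ τ`. -/
def eulerOp (s τ : ℝ) (p : ℝ[X]) : ℝ[X] :=
  (C s * (1 - X) - C τ * X) * p + X * (1 - X) * derivative p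

lemma hasDerivAt_zpoly (p : ℝ[X]) {r : ℝ} (hr : 0 < r) :
    HasDerivAt (zpoly q s τ p) (q / r * zpoly q s τ (eulerOp s τ p) r) r := by
  have h1 := hasDerivAt_zp (q := q) (a := s) (b := τ) hr
  have h2 := (p.hasDerivAt (zc q r)).comp r (hasDerivAt_zc (q := q) hr)
  refine (h1.mul h2).congr_deriv ?_
  simp only [zpoly, eulerOp, Function.comp_apply, eval_add, eval_sub, eval_mul, eval_C, eval_X,
    eval_one]
  ring

lemma contDiffAt_zpoly (p : ℝ[X]) {r : ℝ} (hr : 0 < r) : ContDiffAt ℝ ∞ (zpoly q s τ p) r :=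
  (contDiffAt_zp hr).mul
    ((p.contDiff_aeval (R := ℝ) ∞).contDiffAt.comp r (contDiffAt_zc hr))

lemma exists_bound_zpoly (p : ℝ[X]) :
    ∃ M, 0 < M ∧ ∀ r, 0 < r → |zpoly q s τ p r| ≤ M * zp q s τ r := by
  obtain ⟨M, hM0, hM⟩ := exists_bound_eval p
  refine ⟨M, hM0, fun r hr => ?_⟩
  rw [zpoly, abs_mul, abs_of_pos (zp_pos hr), mul_comm]
  exact mul_le_mul_of_nonneg_right (hM _ (zc_mem_Icc hr)) (zp_pos hr).le

/-- The admissible exponents: `s ≥ 0` is the larger exponent of the equation at `z = 0`, and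
`τ ≥ ε` the larger one at `z = 1`. -/
structure Exponents (β ε m s τ : ℝ) : Prop where
  hβ : 0 < β
  hε : 0 < ε
  hs : 0 ≤ s
  hτ : ε ≤ τ
  hsm : s ^ 2 + β * s = m
  hτm : τ ^ 2 - ε * τ = m

/-- The `k`-th eigenvalue of the equation `IsSol`. -/
def lam (β ε s τ : ℝ) (k : ℕ) : ℝ :=
  (s + τ) * (s + τ + (β - ε) + 1) + k * (k + (2 * s + β) + (2 * τ - ε) + 1)

/-- The Jacobi polynomial in the `k`-th eigenfunction. -/
def jpoly (β ε s τ : ℝ) (k : ℕ) : ℝ[X] := jac (2 * s + β) (2 * τ - ε) k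

/-- The `k`-th eigenfunction `z ^ s * (1 - z) ^ τ * J z` of the equation `IsSol`. -/
def psi (q β ε s τ : ℝ) (k : ℕ) : ℝ → ℝ := zpoly q s τ (jpoly β ε s τ k)

lemma lam_strictMono (hE : Exponents β ε m s τ) : StrictMono (lam β ε s τ) := by
  refine strictMono_nat_of_lt_succ fun k => ?_
  have := hE.hβ; have := hE.hε; have := hE.hs; have := hE.hτ
  unfold lam
  push_cast
  nlinarith [(Nat.cast_nonneg k : (0 : ℝ) ≤ k)]

lemma tendsto_lam (hE : Exponents β ε m s τ) : Tendsto (lam β ε s τ) atTop atTop := by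
  have := hE.hβ; have := hE.hε; have := hE.hs; have := hE.hτ
  refine tendsto_atTop_mono (fun k => ?_) (tendsto_natCast_atTop_atTop.atTop_add
    (tendsto_const_nhds (x := (s + τ) * (s + τ + (β - ε) + 1))))
  unfold lam
  nlinarith [(Nat.cast_nonneg k : (0 : ℝ) ≤ k), sq_nonneg (k : ℝ)]

lemma isSol_psi (hE : Exponents β ε m s τ) (k : ℕ) :
    IsSol q β ε m (lam β ε s τ k) (psi q β ε s τ k) := by
  intro r hr
  refine ⟨(hasDerivAt_zpoly _ hr).differentiableAt, ?_⟩
  set J := jpoly β ε s τ k with hJ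
  have hev : (fun x => x * zp q β (-ε) x * deriv (psi q β ε s τ k) x) =ᶠ[𝓝 r]
      fun x => q * zpoly q (β + s) (-ε + τ) (eulerOp s τ J) x := by
    filter_upwards [Ioi_mem_nhds hr] with x hx
    have hx : 0 < x := hx
    rw [psi, (hasDerivAt_zpoly _ hx).deriv, zpoly, zpoly, ← zp_mul hx, ← hJ]
    field_simp
  refine HasDerivAt.congr_of_eventuallyEq ?_ hev
  refine ((hasDerivAt_zpoly (q := q) (s := β + s) (τ := -ε + τ) (eulerOp s τ J) hr).const_mul
    q).congr_deriv ?_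
  have hA : (0 : ℝ) ≤ 2 * s + β := by linarith [hE.hβ, hE.hs]
  -- `hE.hsm` and `hE.hτm` say that the coefficient of `J` vanishes at `z = 0` and `z = 1`, so that
  -- the equation is divisible by `z (1 - z)`
  have hode := jac_ode (B := 2 * τ - ε) (k := k) hA (zc q r)
  rw [← jpoly, ← hJ] at hode
  have hs := hE.hsm
  have hτ := hE.hτm
  have main : (eulerOp (β + s) (-ε + τ) (eulerOp s τ J)).eval (zc q r)
      = (m - lam β ε s τ k * (zc q r * (1 - zc q r))) * J.eval (zc q r) := by
    simp only [eulerOp, lam, derivative_add, derivative_sub, derivative_mul, derivative_C,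
      derivative_X, derivative_one, eval_add, eval_sub, eval_mul, eval_C, eval_X, eval_one,
      eval_zero]
    linear_combination (zc q r * (1 - zc q r)) * hode
      + (1 - zc q r) * J.eval (zc q r) * hs + zc q r * J.eval (zc q r) * hτ
  rw [zpoly, psi, ← hJ, zpoly, main, zp_one_one, ← zp_mul hr]
  field_simp

end

section

open Polynomial

variable {q β ε m l l' s τ : ℝ} {f g : ℝ → ℝ} {k : ℕ}

/-! ### Green's identity and the classification of admissible solutions -/

/-- The growth condition that membership in the energy space implies. -/
def EnergyBound (q β ε : ℝ) (f : ℝ → ℝ) : Prop :=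
  ∃ M, ∀ r, 0 < r → |f r| ≤ M * zp q (-(β / 2)) (ε / 2) r

/-- The behaviour of the eigenfunctions at the two ends: bounded by `(1 - z) ^ ε`, together with
`r f'`. -/
def RegularBound (q ε : ℝ) (f : ℝ → ℝ) : Prop :=
  ∃ M, ∀ r, 0 < r → |f r| ≤ M * zp q 0 ε r ∧ |r * deriv f r| ≤ M * zp q 0 ε r

/-- The weight `z ^ (β + 1) * (1 - z) ^ (1 - ε) / r` of the eigenvalue parameter. -/
def wt (q β ε r : ℝ) : ℝ := zp q (β + 1) (1 - ε) r / r

lemma wt_pos {r : ℝ} (hr : 0 < r) : 0 < wt q β ε r := div_pos (zp_pos hr) hr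

lemma continuousOn_wt : ContinuousOn (wt q β ε) (Ioi 0) :=
  continuousOn_zp.div continuousOn_id (fun _ hr => ne_of_gt hr)

lemma regularBound_psi (hq : 0 < q) (hE : Exponents β ε m s τ) (k : ℕ) :
    RegularBound q ε (psi q β ε s τ k) := by
  obtain ⟨M₁, hM₁, h₁⟩ := exists_bound_zpoly (q := q) (s := s) (τ := τ) (jpoly β ε s τ k)
  obtain ⟨M₂, hM₂, h₂⟩ := exists_bound_zpoly (q := q) (s := s) (τ := τ)
    (eulerOp s τ (jpoly β ε s τ k))
  refine ⟨max M₁ (q * M₂), fun r hr => ?_⟩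
  have hz : zp q s τ r ≤ zp q 0 ε r := zp_le_zp hr hE.hs hE.hτ
  have hz0 := zp_pos (q := q) (a := s) (b := τ) hr
  constructor
  · calc |psi q β ε s τ k r| ≤ M₁ * zp q s τ r := h₁ r hr
      _ ≤ _ := mul_le_mul (le_max_left _ _) hz hz0.le (by positivity)
  · rw [psi, (hasDerivAt_zpoly _ hr).deriv, ← mul_assoc, mul_div_cancel₀ _ hr.ne', abs_mul,
      abs_of_pos hq]
    calc q * |zpoly q s τ (eulerOp s τ (jpoly β ε s τ k)) r| ≤ q * (M₂ * zp q s τ r) := by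
          gcongr; exact h₂ r hr
      _ = (q * M₂) * zp q s τ r := by ring
      _ ≤ _ := mul_le_mul (le_max_right _ _) hz hz0.le (by positivity)

lemma RegularBound.energyBound (hβ : 0 < β) (hε : 0 < ε) (hf : RegularBound q ε f) :
    EnergyBound q β ε f := by
  obtain ⟨M, hM⟩ := hf
  refine ⟨|M|, fun r hr => (hM r hr).1.trans ?_⟩
  calc M * zp q 0 ε r ≤ |M| * zp q 0 ε r :=
        mul_le_mul_of_nonneg_right (le_abs_self M) (zp_pos hr).le
    _ ≤ _ := mul_le_mul_of_nonneg_left (zp_le_zp hr (by linarith) (by linarith)) (abs_nonneg M)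

lemma integrableOn_wt_mul (hq : 0 < q) (hβ : 0 < β) (hε : 0 < ε) (hf : EnergyBound q β ε f)
    (hfc : ContinuousOn f (Ioi 0)) (hg : RegularBound q ε g) (hgc : ContinuousOn g (Ioi 0)) :
    IntegrableOn (fun r => wt q β ε r * f r * g r) (Ioi 0) := by
  obtain ⟨M, hM⟩ := hf
  obtain ⟨N, hN⟩ := hg
  refine Integrable.mono' ((integrableOn_zp_div hq (a := β / 2 + 1) (b := 1 + ε / 2)
    (by linarith) (by linarith)).const_mul (M * N)) ?_ ?_
  · exact ((continuousOn_wt.mul hfc).mul hgc).aestronglyMeasurable measurableSet_Ioi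
  · filter_upwards [ae_restrict_mem measurableSet_Ioi] with r hr
    have hr : 0 < r := hr
    rw [Real.norm_eq_abs, abs_mul, abs_mul, abs_of_pos (wt_pos hr)]
    have e1 : zp q (β / 2 + 1) (1 + ε / 2) r
        = zp q (β + 1) (1 - ε) r * zp q (-(β / 2)) (ε / 2) r * zp q 0 ε r := by
      rw [zp_mul hr, zp_mul hr]
      congr 1 <;> ring
    calc wt q β ε r * |f r| * |g r|
        ≤ wt q β ε r * (M * zp q (-(β / 2)) (ε / 2) r) * (N * zp q 0 ε r) := by
          have := (wt_pos (q := q) (β := β) (ε := ε) hr).le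
          have := (hN r hr).1
          have h3 := hM r hr
          have := (abs_nonneg _).trans h3
          gcongr
      _ = _ := by rw [e1, wt]; ring

/-- **Green's identity.** Two solutions with different parameters, one in the energy space and one
regular at both ends, are orthogonal: the boundary terms vanish along suitable sequences. The
derivative of the first solution is controlled only at points `ξ ∈ (ρ, 2ρ)` given by the mean
value theorem. -/
lemma green (hq : 0 < q) (hβ : 0 < β) (hε : 0 < ε) (hf : IsSol q β ε m l f)
    (hfb : EnergyBound q β ε f) (hg : IsSol q β ε m l' g) (hgb : RegularBound q ε g) :
    (l - l') * ∫ r in Ioi (0 : ℝ), wt q β ε r * f r * g r = 0 := by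
  have hint := integrableOn_wt_mul hq hβ hε hfb hf.continuousOn hgb hg.continuousOn
  obtain ⟨M, hM⟩ := hfb
  obtain ⟨N, hN⟩ := hgb
  have hM0 : 0 ≤ M := by
    have := (abs_nonneg _).trans (hM 1 one_pos)
    exact nonneg_of_mul_nonneg_left this (zp_pos one_pos)
  have hN0 : 0 ≤ N := by
    have := (abs_nonneg _).trans (hN 1 one_pos).1
    exact nonneg_of_mul_nonneg_left this (zp_pos one_pos)
  let W : ℝ → ℝ := fun r => f r * (r * zp q β (-ε) r * deriv g r)
    - g r * (r * zp q β (-ε) r * deriv f r)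
  have hW : ∀ r, 0 < r → HasDerivAt W (q ^ 2 * ((l - l') * (wt q β ε r * f r * g r))) r := by
    intro r hr
    have h1 := (hf r hr).1.hasDerivAt.mul (hg r hr).2
    have h2 := (hg r hr).1.hasDerivAt.mul (hf r hr).2
    refine (h1.sub h2).congr_deriv ?_
    have e : zp q (β + 1) (1 - ε) r = zp q 1 1 r * zp q β (-ε) r := by
      rw [zp_mul hr]
      congr 1
      ring
    rw [wt, e]
    ring
  set K : ℝ := (2 ^ q) ^ (β / 2 + ε / 2) with hK
  have hK1 : 1 ≤ K := Real.one_le_rpow (Real.one_le_rpow (by norm_num) hq.le) (by linarith)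
  -- in every dyadic interval `W` is somewhere small
  have hmvt : ∀ ρ, 0 < ρ → ∃ ξ ∈ Ioo ρ (2 * ρ),
      |W ξ| ≤ (M * N + 4 * K * M * N) * zp q (β / 2) (ε / 2) ξ := by
    intro ρ hρ
    obtain ⟨ξ, hξ, hξd⟩ := exists_deriv_eq_slope f (a := ρ) (b := 2 * ρ) (by linarith)
      (hf.continuousOn.mono fun x hx => hρ.trans_le hx.1)
      (fun x hx => (hf x (hρ.trans hx.1)).1.differentiableWithinAt)
    refine ⟨ξ, hξ, ?_⟩
    have hξ0 : 0 < ξ := hρ.trans hξ.1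
    have e1 : |f ρ| ≤ M * (K * zp q (-(β / 2)) (ε / 2) ξ) := by
      refine (hM ρ hρ).trans (mul_le_mul_of_nonneg_left ?_ hM0)
      exact zp_neg_le_of_le_two_mul hq (by linarith) (by linarith) hρ hξ0 hξ.2.le
    have e2 : |f (2 * ρ)| ≤ M * (K * zp q (-(β / 2)) (ε / 2) ξ) := by
      refine (hM _ (by linarith)).trans (mul_le_mul_of_nonneg_left ?_ hM0)
      refine zp_neg_le_of_le_two_mul hq (by linarith) (by linarith) (by linarith) hξ0 ?_
      linarith [hξ.2]
    have e3 : |ξ * deriv f ξ| ≤ 4 * K * M * zp q (-(β / 2)) (ε / 2) ξ := by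
      rw [hξd, abs_mul, abs_of_pos hξ0, abs_div, abs_of_pos (show 0 < 2 * ρ - ρ by linarith),
        mul_div_assoc', div_le_iff₀ (by linarith)]
      have h1 : |f (2 * ρ) - f ρ| ≤ 2 * (M * (K * zp q (-(β / 2)) (ε / 2) ξ)) := by
        linarith [abs_sub (f (2 * ρ)) (f ρ)]
      calc ξ * |f (2 * ρ) - f ρ| ≤ (2 * ρ) * (2 * (M * (K * zp q (-(β / 2)) (ε / 2) ξ))) :=
            mul_le_mul hξ.2.le h1 (abs_nonneg _) (by linarith)
        _ = _ := by ring
    have e4 : zp q (β / 2) (ε / 2) ξ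
        = zp q β (-ε) ξ * zp q (-(β / 2)) (ε / 2) ξ * zp q 0 ε ξ := by
      rw [zp_mul hξ0, zp_mul hξ0]
      congr 1 <;> ring
    have p1 := (zp_pos (q := q) (a := β) (b := -ε) hξ0).le
    have p2 := (zp_pos (q := q) (a := -(β / 2)) (b := ε / 2) hξ0).le
    have p3 := (zp_pos (q := q) (a := 0) (b := ε) hξ0).le
    have t1 : |f ξ * (ξ * zp q β (-ε) ξ * deriv g ξ)| ≤ M * N * zp q (β / 2) (ε / 2) ξ := by
      have : f ξ * (ξ * zp q β (-ε) ξ * deriv g ξ) = zp q β (-ε) ξ * (f ξ * (ξ * deriv g ξ)) := by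
        ring
      rw [this, abs_mul, abs_mul, abs_of_nonneg p1, e4]
      calc _ ≤ zp q β (-ε) ξ * ((M * zp q (-(β / 2)) (ε / 2) ξ) * (N * zp q 0 ε ξ)) := by
            have := hM ξ hξ0
            have := (hN ξ hξ0).2
            gcongr
        _ = _ := by ring
    have t2 : |g ξ * (ξ * zp q β (-ε) ξ * deriv f ξ)|
        ≤ 4 * K * M * N * zp q (β / 2) (ε / 2) ξ := by
      have : g ξ * (ξ * zp q β (-ε) ξ * deriv f ξ) = zp q β (-ε) ξ * ((ξ * deriv f ξ) * g ξ) := by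
        ring
      rw [this, abs_mul, abs_mul, abs_of_nonneg p1, e4]
      calc _ ≤ zp q β (-ε) ξ
            * ((4 * K * M * zp q (-(β / 2)) (ε / 2) ξ) * (N * zp q 0 ε ξ)) := by
            have := (hN ξ hξ0).1
            gcongr
        _ = _ := by ring
    calc |W ξ| ≤ _ := abs_sub _ _
      _ ≤ _ := add_le_add t1 t2
      _ = _ := by ring
  have hρ : ∀ n : ℕ, (0 : ℝ) < 1 / ((n : ℝ) + 1) := fun n => by positivity
  choose x hx hxW using fun n : ℕ => hmvt _ (hρ n)
  choose y hy hyW using fun n : ℕ => hmvt ((n : ℝ) + 1) (by positivity)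
  have hx0 : ∀ n, 0 < x n := fun n => (hρ n).trans (hx n).1
  have hxt : Tendsto x atTop (𝓝 0) := by
    refine squeeze_zero (fun n => (hx0 n).le) (fun n => (hx n).2.le) ?_
    simpa using (tendsto_one_div_add_atTop_nhds_zero_nat (𝕜 := ℝ)).const_mul 2
  have hyt : Tendsto y atTop atTop := by
    refine tendsto_atTop_mono (fun n => ?_) (tendsto_natCast_atTop_atTop (R := ℝ))
    linarith [(hy n).1]
  have hWx : Tendsto (fun n => W (x n)) atTop (𝓝 0) := by
    refine squeeze_zero_norm hxW ?_
    have h1 : Tendsto x atTop (𝓝[>] 0) :=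
      tendsto_nhdsWithin_iff.2 ⟨hxt, Eventually.of_forall hx0⟩
    simpa using ((tendsto_zp_zero hq (a := β / 2) (b := ε / 2) (by linarith)
      (by linarith)).comp h1).const_mul (M * N + 4 * K * M * N)
  have hWy : Tendsto (fun n => W (y n)) atTop (𝓝 0) := by
    refine squeeze_zero_norm hyW ?_
    simpa using ((tendsto_zp_atTop hq (a := β / 2) (b := ε / 2) (by linarith)
      (by linarith)).comp hyt).const_mul (M * N + 4 * K * M * N)
  have := integral_Ioi_eq_zero_of_tendsto_seq hW ((hint.const_mul _).const_mul _) hx0 hxt hyt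
    hWx hWy
  rw [integral_const_mul, integral_const_mul] at this
  exact (mul_eq_zero.1 this).resolve_left (by positivity)

/-- The density against which the moments of a solution `f` are taken. -/
def dens (q β ε s τ : ℝ) (f : ℝ → ℝ) (r : ℝ) : ℝ := wt q β ε r * f r * zp q s τ r

lemma continuousOn_dens (hf : ContinuousOn f (Ioi 0)) :
    ContinuousOn (dens q β ε s τ f) (Ioi 0) :=
  (continuousOn_wt.mul hf).mul continuousOn_zp

lemma integrableOn_dens (hq : 0 < q) (hE : Exponents β ε m s τ) (hf : EnergyBound q β ε f)
    (hfc : ContinuousOn f (Ioi 0)) : IntegrableOn (dens q β ε s τ f) (Ioi 0) := by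
  have h := regularBound_psi hq hE 0
  have e : psi q β ε s τ 0 = zp q s τ := by
    ext r
    simp [psi, zpoly, jpoly, jac, jacCoeff]
  rw [e] at h
  exact integrableOn_wt_mul hq hE.hβ hE.hε hf hfc h continuousOn_zp

lemma integral_dens_jpoly (hq : 0 < q) (hE : Exponents β ε m s τ) (hf : IsSol q β ε m l f)
    (hfb : EnergyBound q β ε f) (hl : l ≠ lam β ε s τ k) :
    ∫ r in Ioi (0 : ℝ), dens q β ε s τ f r * (jpoly β ε s τ k).eval (zc q r) = 0 := by
  have := green hq hE.hβ hE.hε hf hfb (isSol_psi hE k) (regularBound_psi hq hE k)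
  have := (mul_eq_zero.1 this).resolve_left (sub_ne_zero.2 hl)
  simpa only [dens, psi, zpoly, mul_assoc] using this

/-- The polynomials `jpoly` span, so a function orthogonal to all of them vanishes. -/
lemma eq_zero_of_integral_dens_jpoly (hq : 0 < q) (hE : Exponents β ε m s τ)
    (hfb : EnergyBound q β ε f) (hfc : ContinuousOn f (Ioi 0))
    (h0 : ∀ k, ∫ r in Ioi (0 : ℝ), dens q β ε s τ f r * (jpoly β ε s τ k).eval (zc q r) = 0) :
    ∀ r, 0 < r → f r = 0 := by
  have hA : (0 : ℝ) ≤ 2 * s + β := by linarith [hE.hβ, hE.hs]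
  have hB : (0 : ℝ) ≤ 2 * τ - ε := by linarith [hE.hε, hE.hτ]
  have hint := integrableOn_dens hq hE hfb hfc
  have h1 := eq_zero_of_moments hq (continuousOn_dens hfc) hint (fun p =>
    integral_mul_eval_eq_zero_of_mem_span hint (S := range (jac (2 * s + β) (2 * τ - ε)))
      (by rintro _ ⟨k, rfl⟩; exact h0 k) (by rw [span_jac hA hB]; trivial))
  intro r hr
  have h2 := h1 r hr
  have h3 := (wt_pos (q := q) (β := β) (ε := ε) hr).ne'
  have h4 := (zp_pos (q := q) (a := s) (b := τ) hr).ne'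
  simpa [dens, h3, h4] using h2

lemma jpoly_ne_zero (k : ℕ) : jpoly β ε s τ k ≠ 0 := by
  intro h
  have := eval_zero_jac (A := 2 * s + β) (B := 2 * τ - ε) (k := k)
  rw [jpoly] at h
  simp [h] at this

lemma eq_zero_of_eval_zc_eq_zero (hq : 0 < q) {p : ℝ[X]}
    (h : ∀ r, 0 < r → p.eval (zc q r) = 0) : p = 0 := by
  refine p.eq_zero_of_infinite_isRoot ((Ioo_infinite (zero_lt_one' ℝ)).mono fun t ht => ?_)
  obtain ⟨r, hr, rfl⟩ := exists_zc_eq hq ht.1 ht.2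
  exact h r hr

lemma exists_psi_ne_zero (hq : 0 < q) (k : ℕ) : ∃ r, 0 < r ∧ psi q β ε s τ k r ≠ 0 := by
  by_contra! h
  refine jpoly_ne_zero (β := β) (ε := ε) (s := s) (τ := τ) k
    (eq_zero_of_eval_zc_eq_zero hq fun r hr => ?_)
  exact (mul_eq_zero.1 (h r hr)).resolve_left (zp_pos hr).ne'

/-- Every nonzero solution that obeys the energy bound is a multiple of some `psi k`: otherwise,
by Green's identity, it is orthogonal to a complete system. -/
theorem exists_eq_psi (hq : 0 < q) (hE : Exponents β ε m s τ) (hf : IsSol q β ε m l f)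
    (hfb : EnergyBound q β ε f) (hne : ∃ r, 0 < r ∧ f r ≠ 0) :
    ∃ k, l = lam β ε s τ k ∧ ∃ c, c ≠ 0 ∧ ∀ r, 0 < r → f r = c * psi q β ε s τ k r := by
  obtain ⟨r₀, hr₀, hne⟩ := hne
  by_cases hl : ∃ k, l = lam β ε s τ k
  · obtain ⟨k, rfl⟩ := hl
    refine ⟨k, rfl, ?_⟩
    have hinj := (lam_strictMono hE).injective
    have hψ := isSol_psi (q := q) hE k
    have hψb := (regularBound_psi hq hE k).energyBound hE.hβ hE.hε
    set ψ := psi q β ε s τ k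
    set I : ℝ := ∫ r in Ioi (0 : ℝ), dens q β ε s τ f r * (jpoly β ε s τ k).eval (zc q r)
    set N : ℝ := ∫ r in Ioi (0 : ℝ), dens q β ε s τ ψ r * (jpoly β ε s τ k).eval (zc q r) with hN
    have hN0 : N ≠ 0 := by
      intro h0
      obtain ⟨r, hr, hr'⟩ := exists_psi_ne_zero (β := β) (ε := ε) (s := s) (τ := τ) hq k
      refine hr' (eq_zero_of_integral_dens_jpoly hq hE hψb hψ.continuousOn (fun j => ?_) r hr)
      rcases eq_or_ne k j with rfl | hkj
      · exact h0
      · exact integral_dens_jpoly hq hE hψ hψb (hinj.ne hkj)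
    -- subtract the orthogonal projection onto `psi k`
    set d := I / N
    have hdb : EnergyBound q β ε (fun r => f r - d * ψ r) := by
      obtain ⟨M₁, h₁⟩ := hfb
      obtain ⟨M₂, h₂⟩ := hψb
      refine ⟨M₁ + |d| * M₂, fun r hr => ?_⟩
      have h3 := abs_sub (f r) (d * ψ r)
      rw [abs_mul] at h3
      have h4 := mul_le_mul_of_nonneg_left (h₂ r hr) (abs_nonneg d)
      linarith [h₁ r hr]
    have hfint := integrableOn_dens hq hE hfb hf.continuousOn
    have hψint := integrableOn_dens hq hE hψb hψ.continuousOn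
    have hdiff := eq_zero_of_integral_dens_jpoly hq hE hdb
      (hf.continuousOn.sub (continuousOn_const.mul hψ.continuousOn)) (fun j => by
        have e : ∀ r, dens q β ε s τ (fun r => f r - d * ψ r) r * (jpoly β ε s τ j).eval (zc q r)
            = dens q β ε s τ f r * (jpoly β ε s τ j).eval (zc q r)
              - d * (dens q β ε s τ ψ r * (jpoly β ε s τ j).eval (zc q r)) := fun r => by
          simp only [dens]; ring
        simp only [e]
        rw [integral_sub (integrableOn_mul_comp_zc hfint (jpoly β ε s τ j).continuous)
          ((integrableOn_mul_comp_zc hψint (jpoly β ε s τ j).continuous).const_mul d),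
          integral_const_mul]
        rcases eq_or_ne k j with rfl | hkj
        · rw [← hN, div_mul_cancel₀ _ hN0]
          exact sub_self I
        · rw [integral_dens_jpoly hq hE hf hfb (hinj.ne hkj),
            integral_dens_jpoly hq hE hψ hψb (hinj.ne hkj), mul_zero, sub_zero])
    refine ⟨d, fun hd => ?_, fun r hr => sub_eq_zero.1 (hdiff r hr)⟩
    have := hdiff r₀ hr₀
    rw [hd, zero_mul, sub_zero] at this
    exact hne this
  · push Not at hl
    exact absurd (eq_zero_of_integral_dens_jpoly hq hE hfb hf.continuousOn
      (fun k => integral_dens_jpoly hq hE hf hfb (hl k)) r₀ hr₀) hne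

/-! ### Zeros and boundary values of the eigenfunctions -/

/-- The classical count of the zeros of an orthogonal polynomial: if there were fewer than `k`
sign changes, multiplying by the linear factors at them would give a function of one sign whose
integral vanishes by orthogonality. -/
theorem encard_zeros_psi (hq : 0 < q) (hE : Exponents β ε m s τ) (k : ℕ) :
    {r : ℝ | 0 < r ∧ psi q β ε s τ k r = 0}.encard = k := by
  classical
  have hA : (0 : ℝ) ≤ 2 * s + β := by linarith [hE.hβ, hE.hs]
  have hB : (0 : ℝ) ≤ 2 * τ - ε := by linarith [hE.hε, hE.hτ]
  set J := jpoly β ε s τ k with hJ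
  have hJ0 : J ≠ 0 := jpoly_ne_zero k
  have himage : zc q '' {r : ℝ | 0 < r ∧ psi q β ε s τ k r = 0}
      = {t | t ∈ Ioo (0 : ℝ) 1 ∧ J.eval t = 0} := by
    ext t
    constructor
    · rintro ⟨r, ⟨hr, h0⟩, rfl⟩
      exact ⟨⟨zc_pos hr, zc_lt_one hr⟩, (mul_eq_zero.1 h0).resolve_left (zp_pos hr).ne'⟩
    · rintro ⟨ht, h0⟩
      obtain ⟨r, hr, rfl⟩ := exists_zc_eq hq ht.1 ht.2
      refine ⟨r, ⟨hr, ?_⟩, rfl⟩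
      rw [psi, zpoly, ← hJ, h0, mul_zero]
  have hinj : InjOn (zc q) {r : ℝ | 0 < r ∧ psi q β ε s τ k r = 0} :=
    (zc_strictMonoOn hq).injOn.mono fun r hr => hr.1
  rw [← hinj.encard_image, himage]
  refine le_antisymm ?_ ?_
  · calc {t | t ∈ Ioo (0 : ℝ) 1 ∧ J.eval t = 0}.encard ≤ (J.roots.toFinset : Set ℝ).encard := by
          refine encard_le_encard fun t ht => ?_
          rw [Finset.mem_coe, Multiset.mem_toFinset, mem_roots hJ0]
          exact ht.2
      _ = (J.roots.toFinset.card : ℕ∞) := encard_coe_eq_coe_finsetCard _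
      _ ≤ k := by
          refine Nat.cast_le.2 ((Multiset.toFinset_card_le _).trans ((card_roots' J).trans ?_))
          exact natDegree_le_of_degree_le (degree_jac hA hB).le
  · obtain ⟨S, e, hS, he, hsign⟩ := exists_prod_mul_nonneg J hJ0
    have hcard : k ≤ S.card := by
      by_contra! hlt
      have hψ := isSol_psi (q := q) hE k
      have hψb := (regularBound_psi hq hE k).energyBound hE.hβ hE.hε
      have hint := integrableOn_dens hq hE hψb hψ.continuousOn
      set T : ℝ[X] := ∏ y ∈ S, (X - C y) with hT
      have hT0 : T ≠ 0 := Finset.prod_ne_zero_iff.2 fun y _ => X_sub_C_ne_zero y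
      have hmem : T ∈ Submodule.span ℝ (jac (2 * s + β) (2 * τ - ε) '' Iio k) := by
        rw [span_jac_lt hA hB, mem_degreeLT, degree_eq_natDegree hT0, hT,
          natDegree_prod_of_monic _ _ fun y _ => monic_X_sub_C y]
        simpa using hlt
      have horth := integral_mul_eval_eq_zero_of_mem_span hint (by
        rintro _ ⟨j, hj, rfl⟩
        exact integral_dens_jpoly hq hE hψ hψb
          ((lam_strictMono hE).injective.ne (ne_of_gt hj))) hmem
      have hval : ∀ r, e * (dens q β ε s τ (psi q β ε s τ k) r * T.eval (zc q r))
          = wt q β ε r * zp q s τ r ^ 2 * (e * (J * T).eval (zc q r)) := fun r => by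
        rw [dens, psi, zpoly, eval_mul]
        ring
      have hzero := eq_zero_of_integral_eq_zero
        (h := fun r => e * (dens q β ε s τ (psi q β ε s τ k) r * T.eval (zc q r)))
        (continuousOn_const.mul ((continuousOn_dens hψ.continuousOn).mul
          (continuousOn_eval_zc T)))
        ((integrableOn_mul_comp_zc hint T.continuous).const_mul e)
        (fun r hr => by
          rw [hval]
          exact mul_nonneg (mul_nonneg (wt_pos hr).le (sq_nonneg _))
            (hsign _ ⟨zc_pos hr, zc_lt_one hr⟩))
        (by rw [integral_const_mul, horth, mul_zero])
      refine mul_ne_zero hJ0 hT0 (eq_zero_of_eval_zc_eq_zero hq fun r hr => ?_)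
      have h1 := hzero r hr
      rw [hval] at h1
      have h2 : wt q β ε r * zp q s τ r ^ 2 ≠ 0 :=
        mul_ne_zero (wt_pos hr).ne' (pow_ne_zero _ (zp_pos hr).ne')
      exact (mul_eq_zero.1 ((mul_eq_zero.1 h1).resolve_left h2)).resolve_left he
    calc (k : ℕ∞) ≤ S.card := Nat.cast_le.2 hcard
      _ = (S : Set ℝ).encard := (encard_coe_eq_coe_finsetCard _).symm
      _ ≤ _ := encard_le_encard fun t ht => hS t ht

lemma exists_tendsto_psi (hq : 0 < q) (hE : Exponents β ε m s τ) (k : ℕ) :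
    ∃ x, Tendsto (psi q β ε s τ k) (𝓝[>] 0) (𝓝 x) := by
  have hz := tendsto_zc_zero hq
  have h1 := hz.rpow_const (p := s) (Or.inr hE.hs)
  have h2 := (hz.const_sub 1).rpow_const (p := τ) (Or.inl (by norm_num))
  have h3 := ((jpoly β ε s τ k).continuous.tendsto 0).comp hz
  exact ⟨_, (h1.mul h2).mul h3⟩

end

section

variable {q β ε : ℝ} {f φ : ℝ → ℝ}

/-! ### The energy space -/

/-- A Hardy-type inequality. With `U = z ^ β (1 - z) ^ (-ε)` one has `r U' ≥ c U`, hence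
`(φ ^ 2 U)' ≥ -c⁻¹ r U φ' ^ 2`, and this is integrated from `r` to the end of the support. -/
lemma sq_mul_zp_le (hq : 0 < q) (hβ : 0 < β) (hε : 0 < ε) (hφ : ContDiff ℝ ∞ φ)
    (hsupp : HasCompactSupport φ) {r : ℝ} (hr : 0 < r) :
    ENNReal.ofReal (q * min β ε * (φ r ^ 2 * zp q β (-ε) r)) ≤
      ∫⁻ x in Ioi (0 : ℝ), ENNReal.ofReal (deriv φ x ^ 2 * (x * zp q β (-ε) x)) := by
  set c := q * min β ε with hc
  have hc0 : 0 < c := mul_pos hq (lt_min hβ hε)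
  obtain ⟨R, hrR, hR0⟩ : ∃ R, r ≤ R ∧ φ R = 0 := by
    obtain ⟨R, hR⟩ := hsupp.isCompact.bddAbove
    refine ⟨max r (R + 1), le_max_left _ _, image_eq_zero_of_notMem_tsupport fun h => ?_⟩
    linarith [hR h, le_max_right r (R + 1)]
  have hpos : ∀ x ∈ Icc r R, 0 < x := fun x hx => hr.trans_le hx.1
  have hsub : Icc r R ⊆ Ioi 0 := hpos
  have hφd : ∀ x, HasDerivAt φ (deriv φ x) x := fun x =>
    (hφ.differentiable (by simp) x).hasDerivAt
  have hφc' : Continuous (deriv φ) := hφ.continuous_deriv (by simp)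
  set D : ℝ → ℝ := fun x => 2 * φ x * deriv φ x * zp q β (-ε) x
    + φ x ^ 2 * (q / x * (β * (1 - zc q x) + ε * zc q x) * zp q β (-ε) x)
  have hD : ∀ x, 0 < x → HasDerivAt (fun x => φ x ^ 2 * zp q β (-ε) x) (D x) x := fun x hx => by
    refine (((hφd x).pow 2).mul (hasDerivAt_zp hx)).congr_deriv ?_
    simp only [D, Pi.pow_apply]
    push_cast
    ring
  have hDc : ContinuousOn D (Icc r R) := by
    refine ContinuousOn.mono (s := Ioi 0) ?_ hsub
    have h1 : ContinuousOn (fun x : ℝ => q / x) (Ioi 0) :=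
      continuousOn_const.div continuousOn_id fun x hx => ne_of_gt hx
    have h2 : ContinuousOn (zc q) (Ioi 0) := continuousOn_zc
    have h3 : ContinuousOn (zp q β (-ε)) (Ioi 0) := continuousOn_zp
    have h4 := hφ.continuous
    fun_prop
  set g : ℝ → ℝ := fun x => deriv φ x ^ 2 * (x * zp q β (-ε) x)
  have hgc : ContinuousOn g (Icc r R) := by
    refine ContinuousOn.mono (s := Ioi 0) ?_ hsub
    have h3 : ContinuousOn (zp q β (-ε)) (Ioi 0) := continuousOn_zp
    fun_prop
  have hle : ∀ x ∈ Icc r R, -(c⁻¹ * g x) ≤ D x := by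
    intro x hx
    have hx0 := hpos x hx
    have hz := zc_pos (q := q) hx0
    have hz' := one_sub_zc_pos (q := q) hx0
    have hU := zp_pos (q := q) (a := β) (b := -ε) hx0
    have h1 : c ≤ q * (β * (1 - zc q x) + ε * zc q x) := by
      refine mul_le_mul_of_nonneg_left ?_ hq.le
      nlinarith [min_le_left β ε, min_le_right β ε]
    have h2 : 0 ≤ c * φ x ^ 2 + 2 * φ x * (x * deriv φ x) + c⁻¹ * (x * deriv φ x) ^ 2 := by
      have : c * φ x ^ 2 + 2 * φ x * (x * deriv φ x) + c⁻¹ * (x * deriv φ x) ^ 2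
          = c⁻¹ * (c * φ x + x * deriv φ x) ^ 2 := by
        field_simp
        ring
      rw [this]
      positivity
    have h3 : D x + c⁻¹ * g x = zp q β (-ε) x / x *
        ((c * φ x ^ 2 + 2 * φ x * (x * deriv φ x) + c⁻¹ * (x * deriv φ x) ^ 2)
          + (q * (β * (1 - zc q x) + ε * zc q x) - c) * φ x ^ 2) := by
      simp only [D, g]
      field_simp
      ring
    have h4 : 0 ≤ D x + c⁻¹ * g x := by
      rw [h3]
      exact mul_nonneg (div_nonneg hU.le hx0.le)
        (add_nonneg h2 (mul_nonneg (sub_nonneg.2 h1) (sq_nonneg _)))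
    linarith
  have hDi : IntervalIntegrable D volume r R := by
    refine ContinuousOn.intervalIntegrable ?_
    rwa [uIcc_of_le hrR]
  have hgi : IntervalIntegrable g volume r R := by
    refine ContinuousOn.intervalIntegrable ?_
    rwa [uIcc_of_le hrR]
  have hftc := intervalIntegral.integral_eq_sub_of_hasDerivAt
    (fun x hx => hD x (hpos x (by rwa [uIcc_of_le hrR] at hx))) hDi
  have hmono : ∫ x in r..R, -(c⁻¹ * g x) ≤ ∫ x in r..R, D x :=
    intervalIntegral.integral_mono_on hrR (hgi.const_mul c⁻¹).neg hDi hle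
  rw [hftc, intervalIntegral.integral_neg, intervalIntegral.integral_const_mul, hR0] at hmono
  have hfin : c * (φ r ^ 2 * zp q β (-ε) r) ≤ ∫ x in r..R, g x := by
    have h1 : φ r ^ 2 * zp q β (-ε) r ≤ c⁻¹ * ∫ x in r..R, g x := by
      norm_num at hmono
      linarith
    calc _ ≤ c * (c⁻¹ * ∫ x in r..R, g x) := mul_le_mul_of_nonneg_left h1 hc0.le
      _ = _ := by rw [← mul_assoc, mul_inv_cancel₀ hc0.ne', one_mul]
  refine (ENNReal.ofReal_le_ofReal hfin).trans ?_
  have hsub' : Ioc r R ⊆ Ioi 0 := fun x hx => hr.trans hx.1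
  rw [intervalIntegral.integral_of_le hrR, ofReal_integral_eq_lintegral_ofReal hgi.1 ?_]
  · exact lintegral_mono_set hsub'
  · filter_upwards [ae_restrict_mem measurableSet_Ioc] with x hx
    exact mul_nonneg (sq_nonneg _) (mul_nonneg (hsub' hx).le (zp_pos (hsub' hx)).le)

lemma exists_abs_mul_zp_le (hq : 0 < q) (hβ : 0 < β) (hε : 0 < ε) (hφ : Continuous φ)
    (hsupp : HasCompactSupport φ) :
    ∃ M, ∀ r, 0 < r → |φ r| * zp q (β / 2) (-(ε / 2)) r ≤ M := by
  obtain ⟨A, hA⟩ := hsupp.exists_bound_of_continuous hφ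
  obtain ⟨R, hR⟩ := hsupp.isCompact.bddAbove
  have hR1 : 0 < max R 1 := by positivity
  have hA0 : 0 ≤ A := (norm_nonneg _).trans (hA 0)
  refine ⟨A * (1 - zc q (max R 1)) ^ (-(ε / 2)), fun r hr => ?_⟩
  rcases le_or_gt r (max R 1) with h | h
  · refine mul_le_mul (hA r) ((zp_le_right hr (by linarith)).trans ?_) (zp_pos hr).le hA0
    refine Real.rpow_le_rpow_of_nonpos (one_sub_zc_pos hR1) ?_ (by linarith)
    linarith [(zc_strictMonoOn hq).monotoneOn hr hR1 h]
  · have h0 : φ r = 0 := image_eq_zero_of_notMem_tsupport fun h' => by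
      linarith [hR h', le_max_left R 1]
    rw [h0, abs_zero, zero_mul]
    exact mul_nonneg hA0 (Real.rpow_nonneg (one_sub_zc_pos hR1).le _)

open RadialSL (normSq MemW0)

/-- Elements of the energy space obey the pointwise bound that test functions satisfy uniformly in
terms of their energy. -/
theorem energyBound_of_memW0 {ω₀ ω₁ : ℝ → ℝ} {K : ℝ} (hq : 0 < q) (hβ : 0 < β) (hε : 0 < ε)
    (hK : 0 < K) (hω₀ : ∀ r, 0 < r → 0 < ω₀ r) (hω₀c : ContinuousOn ω₀ (Ioi 0))
    (hω₁ : ∀ r, 0 < r → ω₁ r = K * (r * zp q β (-ε) r)) (hf : MemW0 ω₀ ω₁ f)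
    (hfc : ContinuousOn f (Ioi 0)) : EnergyBound q β ε f := by
  obtain ⟨hfm, g, hgm, φ, hφ, hlim⟩ := hf
  set δ : ℕ → ℝ≥0∞ := fun k => normSq ω₀ ω₁ (fun r => f r - φ k r) (fun r => g r - deriv (φ k) r)
  obtain ⟨k₀, hk₀⟩ := eventually_atTop.1 (hlim.eventually_lt_const (zero_lt_one' ℝ≥0∞))
  have hω₁0 : ∀ r, 0 < r → 0 < ω₁ r := fun r hr => by
    rw [hω₁ r hr]
    exact mul_pos hK (mul_pos hr (zp_pos hr))
  have hω₁m : AEMeasurable ω₁ (volume.restrict (Ioi 0)) := by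
    have h1 : ContinuousOn ω₁ (Ioi 0) :=
      (continuousOn_const.mul (continuousOn_id.mul continuousOn_zp)).congr hω₁
    exact h1.aemeasurable measurableSet_Ioi
  -- the gradient part of the distance to a test function
  have hgrad : ∀ k,
      ∫⁻ x in Ioi (0 : ℝ), ENNReal.ofReal ((g x - deriv (φ k) x) ^ 2 * ω₁ x) ≤ δ k := by
    intro k
    refine setLIntegral_mono_ae' measurableSet_Ioi (ae_of_all _ fun x hx => ?_)
    refine ENNReal.ofReal_le_ofReal (le_add_of_nonneg_left ?_)
    exact mul_nonneg (sq_nonneg _) (hω₀ x hx).le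
  have hdm : ∀ k, Measurable (deriv (φ k)) := fun k => measurable_deriv _
  set c := q * min β ε with hc
  have hc0 : 0 < c := mul_pos hq (lt_min hβ hε)
  -- a bound for differences of test functions, uniform in `k`
  have hbound : ∀ k, k₀ ≤ k → ∀ r, 0 < r →
      |φ k r - φ k₀ r| * zp q (β / 2) (-(ε / 2)) r ≤ √(4 / (K * c)) := by
    intro k hk r hr
    have hd : ∀ x, deriv (fun x => φ k x - φ k₀ x) x = deriv (φ k) x - deriv (φ k₀) x := fun x =>
      deriv_fun_sub ((hφ k).1.differentiable (by simp) x) ((hφ k₀).1.differentiable (by simp) x)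
    have h1 := sq_mul_zp_le (φ := fun x => φ k x - φ k₀ x) hq hβ hε ((hφ k).1.sub (hφ k₀).1)
      ((hφ k).2.sub (hφ k₀).2) hr
    have h2 : ENNReal.ofReal K * ∫⁻ x in Ioi (0 : ℝ),
        ENNReal.ofReal (deriv (fun x => φ k x - φ k₀ x) x ^ 2 * (x * zp q β (-ε) x)) ≤ 4 := by
      rw [← lintegral_const_mul' _ _ ENNReal.ofReal_ne_top]
      calc _ ≤ ∫⁻ x in Ioi (0 : ℝ), (2 * ENNReal.ofReal ((g x - deriv (φ k) x) ^ 2 * ω₁ x)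
            + 2 * ENNReal.ofReal ((g x - deriv (φ k₀) x) ^ 2 * ω₁ x)) := by
            refine setLIntegral_mono_ae' measurableSet_Ioi (ae_of_all _ fun x hx => ?_)
            have hx : 0 < x := hx
            have e2 : (2 : ℝ≥0∞) = ENNReal.ofReal 2 := by norm_num
            have n1 := mul_nonneg (sq_nonneg (g x - deriv (φ k) x)) (hω₁0 x hx).le
            have n2 := mul_nonneg (sq_nonneg (g x - deriv (φ k₀) x)) (hω₁0 x hx).le
            rw [e2, ← ENNReal.ofReal_mul hK.le, ← ENNReal.ofReal_mul (by norm_num),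
              ← ENNReal.ofReal_mul (by norm_num), ← ENNReal.ofReal_add (by linarith) (by linarith)]
            refine ENNReal.ofReal_le_ofReal ?_
            rw [hd]
            have e3 : K * ((deriv (φ k) x - deriv (φ k₀) x) ^ 2 * (x * zp q β (-ε) x))
                = (deriv (φ k) x - deriv (φ k₀) x) ^ 2 * ω₁ x := by rw [hω₁ x hx]; ring
            rw [e3]
            nlinarith [mul_nonneg (sq_nonneg ((g x - deriv (φ k) x) + (g x - deriv (φ k₀) x)))
              (hω₁0 x hx).le]
        _ = 2 * (∫⁻ x in Ioi (0 : ℝ), ENNReal.ofReal ((g x - deriv (φ k) x) ^ 2 * ω₁ x))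
            + 2 * ∫⁻ x in Ioi (0 : ℝ), ENNReal.ofReal ((g x - deriv (φ k₀) x) ^ 2 * ω₁ x) := by
            rw [lintegral_add_left', lintegral_const_mul' _ _ (by norm_num),
              lintegral_const_mul' _ _ (by norm_num)]
            have := (hdm k).aemeasurable (μ := volume.restrict (Ioi 0))
            fun_prop
        _ ≤ 2 * 1 + 2 * 1 := by
            gcongr
            · exact (hgrad k).trans (hk₀ k hk).le
            · exact (hgrad k₀).trans (hk₀ k₀ le_rfl).le
        _ = 4 := by norm_num
    have h3 := (mul_le_mul_right h1 (ENNReal.ofReal K)).trans h2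
    rw [← ENNReal.ofReal_mul hK.le, ← ENNReal.ofReal_ofNat 4,
      ENNReal.ofReal_le_ofReal_iff (by norm_num)] at h3
    refine Real.le_sqrt_of_sq_le ?_
    rw [mul_pow, sq_abs, zp_sq hr, le_div_iff₀ (mul_pos hK hc0)]
    have e : zp q (2 * (β / 2)) (2 * -(ε / 2)) r = zp q β (-ε) r := by
      congr 1 <;> ring
    rw [e]
    linarith
  -- the same bound in the limit
  set b := √(4 / (K * c))
  have hlimbound : ∀ r, 0 < r → |f r - φ k₀ r| * zp q (β / 2) (-(ε / 2)) r ≤ b := by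
    intro r₀ hr₀
    by_contra! hlt
    obtain ⟨b', hb, hb'⟩ := exists_between hlt
    have hcont : ContinuousOn (fun r => |f r - φ k₀ r| * zp q (β / 2) (-(ε / 2)) r) (Ioi 0) :=
      (hfc.sub (hφ k₀).1.continuous.continuousOn).abs.mul continuousOn_zp
    obtain ⟨r₁, r₂, hr, hsub⟩ := mem_nhds_iff_exists_Ioo_subset.1 (Filter.inter_mem
      ((hcont.continuousAt (Ioi_mem_nhds hr₀)).eventually_const_lt hb') (Ioi_mem_nhds hr₀))
    -- otherwise all `φ k` stay away from `f` by a fixed amount near `r₀`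
    set h : ℝ → ℝ := fun r => ((b' - b) * zp q (-(β / 2)) (ε / 2) r) ^ 2 * ω₀ r
    have hsub0 : Ioo r₁ r₂ ⊆ Ioi 0 := fun r hr' => (hsub hr').2
    have hlow : ∀ k, k₀ ≤ k → ∫⁻ r in Ioo r₁ r₂, ENNReal.ofReal (h r) ≤ δ k := by
      intro k hk
      refine le_trans ?_ (lintegral_mono_set (μ := volume) hsub0)
      refine setLIntegral_mono_ae' measurableSet_Ioo (ae_of_all _ fun r hr' => ?_)
      have hr0 : 0 < r := hsub0 hr'
      refine ENNReal.ofReal_le_ofReal (le_add_of_le_of_nonneg ?_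
        (mul_nonneg (sq_nonneg _) (hω₁0 r hr0).le))
      refine mul_le_mul_of_nonneg_right ?_ (hω₀ r hr0).le
      have hz := zp_pos (q := q) (a := -(β / 2)) (b := ε / 2) hr0
      rw [← sq_abs (f r - φ k r)]
      refine pow_le_pow_left₀ (mul_nonneg (by linarith) hz.le) ?_ 2
      have h1 : b' < |f r - φ k₀ r| * zp q (β / 2) (-(ε / 2)) r := (hsub hr').1
      have h2 := hbound k hk r hr0
      have h3 : |f r - φ k₀ r| ≤ |f r - φ k r| + |φ k r - φ k₀ r| := abs_sub_le _ _ _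
      have h4 : zp q (β / 2) (-(ε / 2)) r * zp q (-(β / 2)) (ε / 2) r = 1 := by
        rw [zp_mul hr0]
        simp [zp]
      have hz' := zp_pos (q := q) (a := β / 2) (b := -(ε / 2)) hr0
      have h5 : b' - b ≤ |f r - φ k r| * zp q (β / 2) (-(ε / 2)) r := by nlinarith
      calc _ ≤ |f r - φ k r| * zp q (β / 2) (-(ε / 2)) r * zp q (-(β / 2)) (ε / 2) r :=
            mul_le_mul_of_nonneg_right h5 hz.le
        _ = |f r - φ k r| := by rw [mul_assoc, h4, mul_one]
    have hzero : ∫⁻ r in Ioo r₁ r₂, ENNReal.ofReal (h r) = 0 :=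
      le_antisymm (ge_of_tendsto hlim (eventually_atTop.2 ⟨k₀, hlow⟩)) zero_le
    have hhm : AEMeasurable (fun r => ENNReal.ofReal (h r)) (volume.restrict (Ioo r₁ r₂)) := by
      have : ContinuousOn h (Ioi 0) := ((continuousOn_const.mul continuousOn_zp).pow 2).mul hω₀c
      exact ((this.mono hsub0).aemeasurable measurableSet_Ioo).ennreal_ofReal
    rw [lintegral_eq_zero_iff' hhm] at hzero
    have hfalse : ∀ᵐ r ∂(volume.restrict (Ioo r₁ r₂)), False := by
      filter_upwards [hzero, ae_restrict_mem measurableSet_Ioo] with r h1 hr'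
      have hr0 : 0 < r := hsub0 hr'
      have h2 : 0 < h r :=
        mul_pos (pow_pos (mul_pos (by linarith) (zp_pos hr0)) 2) (hω₀ r hr0)
      exact absurd h1 (ENNReal.ofReal_pos.2 h2).ne'
    rw [eventually_false_iff_eq_bot, ae_eq_bot, Measure.restrict_eq_zero, Real.volume_Ioo,
      ENNReal.ofReal_eq_zero] at hfalse
    linarith [hr.1, hr.2]
  obtain ⟨M, hM⟩ := exists_abs_mul_zp_le hq hβ hε (hφ k₀).1.continuous (hφ k₀).2
  refine ⟨b + M, fun r hr => ?_⟩
  have h4 : zp q (β / 2) (-(ε / 2)) r * zp q (-(β / 2)) (ε / 2) r = 1 := by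
    rw [zp_mul hr]
    simp [zp]
  have hz := zp_pos (q := q) (a := -(β / 2)) (b := ε / 2) hr
  have hz' := zp_pos (q := q) (a := β / 2) (b := -(ε / 2)) hr
  have h3 : |f r| ≤ |f r - φ k₀ r| + |φ k₀ r| := by
    simpa using abs_add_le (f r - φ k₀ r) (φ k₀ r)
  have h5 : |f r| * zp q (β / 2) (-(ε / 2)) r ≤ b + M := by
    nlinarith [hlimbound r hr, hM r hr]
  calc |f r| = |f r| * zp q (β / 2) (-(ε / 2)) r * zp q (-(β / 2)) (ε / 2) r := by
        rw [mul_assoc, h4, mul_one]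
    _ ≤ _ := mul_le_mul_of_nonneg_right h5 hz.le

/-- Smooth functions on `(0,∞)` that are regular at both ends belong to the energy space: they are
cut off by a bump function of `log r / j`. -/
theorem memW0_of_regularBound {ω₀ ω₁ : ℝ → ℝ} {K N : ℝ} (hq : 0 < q) (hβ : 0 < β) (hε : 0 < ε)
    (hK : 0 < K) (hN : 0 < N) (hω₀ : ∀ r, 0 < r → ω₀ r = N * wt q β ε r)
    (hω₁ : ∀ r, 0 < r → ω₁ r = K * (r * zp q β (-ε) r))
    (hfs : ∀ r, 0 < r → ContDiffAt ℝ ∞ f r) (hfb : RegularBound q ε f) : MemW0 ω₀ ω₁ f := by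
  obtain ⟨M, hM⟩ := hfb
  have hfc : ContinuousOn f (Ioi 0) := fun r hr => (hfs r hr).continuousAt.continuousWithinAt
  let χ : ContDiffBump (0 : ℝ) := ⟨1, 2, one_pos, one_lt_two⟩
  have hχs : ContDiff ℝ ∞ χ := χ.contDiff
  obtain ⟨A, hA⟩ := χ.hasCompactSupport.deriv.exists_bound_of_continuous
    (hχs.continuous_deriv (by simp))
  have hj : ∀ j : ℕ, (0 : ℝ) < (j : ℝ) + 1 := fun j => by positivity
  set φ : ℕ → ℝ → ℝ := fun j r => if 0 < r then f r * χ (Real.log r / (j + 1)) else 0 with hφ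
  have hφev : ∀ (j : ℕ) (r : ℝ), 0 < r →
      φ j =ᶠ[𝓝 r] fun r => f r * χ (Real.log r / (j + 1)) := fun j r hr => by
    filter_upwards [Ioi_mem_nhds hr] with x hx
    exact if_pos hx
  have hvanish : ∀ (j : ℕ) (r : ℝ), r ∉ Icc (Real.exp (-(2 * (j + 1)))) (Real.exp (2 * (j + 1))) →
      φ j r = 0 := by
    intro j r hr
    by_cases h0 : 0 < r
    · have hlog : 2 ≤ |Real.log r / (j + 1)| := by
        rw [abs_div, abs_of_pos (hj j), le_div_iff₀ (hj j)]
        by_contra! hlt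
        obtain ⟨h1, h2⟩ := abs_lt.1 hlt
        refine hr ⟨?_, ?_⟩
        · rw [← Real.exp_log h0]; exact Real.exp_le_exp.2 h1.le
        · rw [← Real.exp_log h0]; exact Real.exp_le_exp.2 h2.le
      simp only [hφ, if_pos h0]
      rw [χ.zero_of_le_dist (by rwa [Real.dist_eq, sub_zero]), mul_zero]
    · simp only [hφ, if_neg h0]
  have hφd : ∀ (j : ℕ) (r : ℝ), 0 < r → deriv (φ j) r = deriv f r * χ (Real.log r / (j + 1))
      + f r * (deriv χ (Real.log r / (j + 1)) * (r⁻¹ / (j + 1))) := by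
    intro j r hr
    have h1 : HasDerivAt (fun x => Real.log x / ((j : ℝ) + 1)) (r⁻¹ / (j + 1)) r :=
      (Real.hasDerivAt_log hr.ne').div_const _
    have h2 : HasDerivAt χ (deriv χ (Real.log r / (j + 1))) (Real.log r / (j + 1)) :=
      (hχs.differentiable (by simp) _).hasDerivAt
    have h3 := ((hfs r hr).differentiableAt (by simp)).hasDerivAt.mul (h2.comp r h1)
    exact (h3.congr_of_eventuallyEq (hφev j r hr)).deriv
  refine ⟨hfc.aemeasurable measurableSet_Ioi, deriv f, (measurable_deriv f).aemeasurable, φ,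
    fun j => ⟨?_, HasCompactSupport.intro isCompact_Icc (hvanish j)⟩, ?_⟩
  · refine contDiff_iff_contDiffAt.2 fun r => ?_
    by_cases hr : 0 < r
    · refine ContDiffAt.congr_of_eventuallyEq ?_ (hφev j r hr)
      exact (hfs r hr).mul (hχs.contDiffAt.comp r
        ((Real.contDiffAt_log.2 hr.ne').div_const _))
    · refine (contDiffAt_const (c := (0 : ℝ))).congr_of_eventuallyEq ?_
      filter_upwards [Iio_mem_nhds ((not_lt.1 hr).trans_lt (Real.exp_pos (-(2 * (j + 1)))))]
        with x hx
      exact hvanish j x fun h => absurd h.1 (not_le.2 hx)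
  · -- all terms are dominated by `z ^ β (1 - z) ^ ε / r`
    set H : ℕ → ℝ → ℝ := fun j r => ((N * M ^ 2 + 2 * K * M ^ 2)
      * (1 - χ (Real.log r / (j + 1))) ^ 2 + 2 * K * M ^ 2 * A ^ 2 / (j + 1) ^ 2)
      * (zp q β ε r / r) with hH
    have hle : ∀ j, normSq ω₀ ω₁ (fun r => f r - φ j r) (fun r => deriv f r - deriv (φ j) r)
        ≤ ∫⁻ r in Ioi (0 : ℝ), ENNReal.ofReal (H j r) := by
      intro j
      refine setLIntegral_mono_ae' measurableSet_Ioi (ae_of_all _ fun r hr => ?_)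
      have hr : 0 < r := hr
      refine ENNReal.ofReal_le_ofReal ?_
      obtain ⟨hM1, hM2⟩ := hM r hr
      have hf2 : f r ^ 2 ≤ M ^ 2 * zp q 0 (2 * ε) r := by
        have := pow_le_pow_left₀ (abs_nonneg _) hM1 2
        rwa [sq_abs, mul_pow, zp_sq hr, mul_zero] at this
      have hd2 : (r * deriv f r) ^ 2 ≤ M ^ 2 * zp q 0 (2 * ε) r := by
        have := pow_le_pow_left₀ (abs_nonneg _) hM2 2
        rwa [sq_abs, mul_pow M, zp_sq hr, mul_zero] at this
      have hA2 : deriv χ (Real.log r / (j + 1)) ^ 2 ≤ A ^ 2 := by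
        rw [← sq_abs]
        exact pow_le_pow_left₀ (abs_nonneg _) (hA _) 2
      set t : ℝ := χ (Real.log r / (j + 1))
      set t' : ℝ := deriv χ (Real.log r / (j + 1))
      have e1 : f r - φ j r = f r * (1 - t) := by
        simp only [hφ, if_pos hr]
        ring
      have e2 : deriv f r - deriv (φ j) r
          = (r * deriv f r * (1 - t) - f r * t' / (j + 1)) / r := by
        rw [hφd j r hr]
        have := (hj j).ne'
        field_simp
        ring
      have e3 : zp q β ε r = zp q β (-ε) r * zp q 0 (2 * ε) r := by
        rw [zp_mul hr]
        congr 1 <;> ring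
      have e4 : zp q (β + 1) (1 - ε) r ≤ zp q β (-ε) r := zp_le_zp hr (by linarith) (by linarith)
      have pz := zp_pos (q := q) (a := β) (b := -ε) hr
      have pz' := zp_pos (q := q) (a := 0) (b := 2 * ε) hr
      have s1 : (f r * (1 - t)) ^ 2 * ω₀ r
          ≤ N * M ^ 2 * (1 - t) ^ 2 * (zp q β ε r / r) := by
        have p1 := zp_pos (q := q) (a := β + 1) (b := 1 - ε) hr
        rw [hω₀ r hr, e3, mul_pow, wt]
        calc f r ^ 2 * (1 - t) ^ 2 * (N * (zp q (β + 1) (1 - ε) r / r))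
            ≤ (M ^ 2 * zp q 0 (2 * ε) r) * (1 - t) ^ 2 * (N * (zp q β (-ε) r / r)) := by
              gcongr
          _ = _ := by ring
      have s2 : ((r * deriv f r * (1 - t) - f r * t' / (j + 1)) / r) ^ 2 * ω₁ r
          ≤ (2 * K * M ^ 2 * (1 - t) ^ 2 + 2 * K * M ^ 2 * A ^ 2 / (j + 1) ^ 2)
            * (zp q β ε r / r) := by
        have h1 : (r * deriv f r * (1 - t) - f r * t' / (j + 1)) ^ 2
            ≤ 2 * ((r * deriv f r) ^ 2 * (1 - t) ^ 2 + f r ^ 2 * t' ^ 2 / (j + 1) ^ 2) := by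
          have h2 := sq_nonneg (r * deriv f r * (1 - t) + f r * t' / (j + 1))
          have h3 : (f r * t' / (j + 1)) ^ 2 = f r ^ 2 * t' ^ 2 / (j + 1) ^ 2 := by
            rw [div_pow, mul_pow]
          nlinarith
        rw [hω₁ r hr, e3]
        calc _ = (r * deriv f r * (1 - t) - f r * t' / (j + 1)) ^ 2
              * (K * (zp q β (-ε) r / r)) := by field_simp
          _ ≤ 2 * ((M ^ 2 * zp q 0 (2 * ε) r) * (1 - t) ^ 2
              + (M ^ 2 * zp q 0 (2 * ε) r) * A ^ 2 / (j + 1) ^ 2)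
              * (K * (zp q β (-ε) r / r)) := by
              refine mul_le_mul_of_nonneg_right (h1.trans ?_) (by positivity)
              gcongr
          _ = _ := by ring
      simp only [hH]
      rw [e1, e2]
      calc _ ≤ _ := add_le_add s1 s2
        _ = _ := by ring
    refine tendsto_of_tendsto_of_tendsto_of_le_of_le tendsto_const_nhds ?_
      (fun _ => zero_le) hle
    have hint := (integrableOn_zp_div hq hβ hε).const_mul
      (N * M ^ 2 + 2 * K * M ^ 2 + 2 * K * M ^ 2 * A ^ 2)
    have hdct := tendsto_lintegral_of_dominated_convergence' (μ := volume.restrict (Ioi (0 : ℝ)))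
      (F := fun j r => ENNReal.ofReal (H j r)) (f := fun _ => 0)
      (fun r => ENNReal.ofReal ((N * M ^ 2 + 2 * K * M ^ 2 + 2 * K * M ^ 2 * A ^ 2)
        * (zp q β ε r / r))) ?_ ?_ hint.lintegral_lt_top.ne ?_
    · simpa using hdct
    · intro j
      have h1 : ContinuousOn (H j) (Ioi 0) := by
        have h2 : ContinuousOn (fun r => Real.log r / ((j : ℝ) + 1)) (Ioi 0) :=
          (Real.continuousOn_log.mono fun r hr => ne_of_gt hr).div_const _
        have h3 : ContinuousOn (fun r => χ (Real.log r / ((j : ℝ) + 1))) (Ioi 0) :=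
          χ.continuous.comp_continuousOn h2
        have h4 : ContinuousOn (fun r => zp q β ε r / r) (Ioi 0) :=
          continuousOn_zp.div continuousOn_id fun r hr => ne_of_gt hr
        exact ((continuousOn_const.mul ((continuousOn_const.sub h3).pow 2)).add
          continuousOn_const).mul h4
      exact (h1.aemeasurable measurableSet_Ioi).ennreal_ofReal
    · intro j
      filter_upwards [ae_restrict_mem measurableSet_Ioi] with r hr
      have hr : 0 < r := hr
      refine ENNReal.ofReal_le_ofReal ?_
      have h1 : 0 ≤ χ (Real.log r / (j + 1)) := χ.nonneg
      have h2 : χ (Real.log r / (j + 1)) ≤ 1 := χ.le_one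
      have h3 : (1 - χ (Real.log r / (j + 1))) ^ 2 ≤ 1 := by nlinarith
      have h4 : 2 * K * M ^ 2 * A ^ 2 / ((j : ℝ) + 1) ^ 2 ≤ 2 * K * M ^ 2 * A ^ 2 :=
        div_le_self (by positivity) (one_le_pow₀ (by linarith [(Nat.cast_nonneg j : (0 : ℝ) ≤ j)]))
      have h5 : (N * M ^ 2 + 2 * K * M ^ 2) * (1 - χ (Real.log r / (j + 1))) ^ 2
          ≤ N * M ^ 2 + 2 * K * M ^ 2 := mul_le_of_le_one_right (by positivity) h3
      exact mul_le_mul_of_nonneg_right (add_le_add h5 h4)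
        (div_nonneg (zp_pos hr).le hr.le)
    · filter_upwards [ae_restrict_mem measurableSet_Ioi] with r hr
      rw [← ENNReal.ofReal_zero]
      refine ENNReal.tendsto_ofReal ?_
      have hjt : Tendsto (fun j : ℕ => (j : ℝ) + 1) atTop atTop :=
        tendsto_atTop_add_const_right _ _ tendsto_natCast_atTop_atTop
      have h1 : Tendsto (fun j : ℕ => χ (Real.log r / ((j : ℝ) + 1))) atTop (𝓝 1) := by
        have h2 : Tendsto (fun j : ℕ => Real.log r / ((j : ℝ) + 1)) atTop (𝓝 0) :=
          hjt.const_div_atTop _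
        have h3 := (χ.continuous.tendsto 0).comp h2
        rwa [χ.one_of_mem_closedBall (by simpa using χ.rIn_pos.le)] at h3
      have h4 : Tendsto (fun j : ℕ => 2 * K * M ^ 2 * A ^ 2 / ((j : ℝ) + 1) ^ 2) atTop (𝓝 0) :=
        ((tendsto_pow_atTop two_ne_zero).comp hjt).const_div_atTop _
      have h5 := (((h1.const_sub 1).pow 2).const_mul (N * M ^ 2 + 2 * K * M ^ 2)).add h4
      simpa using h5.mul_const (zp q β ε r / r)

end

end

end JacobiModel

namespace RadialSL

noncomputable section

open JacobiModel

/-! ### The weights in the variable `z` -/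

/-- The exponent of `z` in `gradWeight n p r / r`. -/
def betaExp (n : ℕ) (p : ℝ) : ℝ := n - n / p - 1

/-- The exponent of `1 - z` in `r / gradWeight n p r`. -/
def epsExp (n : ℕ) (p : ℝ) : ℝ := (n - p) / p

/-- The constant in the formula for `gradWeight`. -/
def gradConst (n : ℕ) (p : ℝ) : ℝ := (kappa n p * pConj p * epsExp n p) ^ (p - 2)

/-- The constant in the formula for `w`. -/
def massConst (n : ℕ) (p : ℝ) : ℝ := kappa n p ^ (pStar n p - 2)

variable {n : ℕ} {p μ α r : ℝ}

lemma pConj_pos (hp : 2 ≤ p) : 0 < pConj p := div_pos (by linarith) (by linarith)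

lemma epsExp_pos (hp : 2 ≤ p) (hpn : p < n) : 0 < epsExp n p :=
  div_pos (by linarith) (by linarith)

lemma betaExp_pos (hp : 2 ≤ p) (hpn : p < n) : 0 < betaExp n p := by
  have hn : (3 : ℝ) ≤ n := by
    have : 2 < n := by exact_mod_cast hp.trans_lt hpn
    exact_mod_cast this
  have h : (n : ℝ) / p ≤ n / 2 := by gcongr
  unfold betaExp
  linarith

lemma profile_eq_zp (hr : 0 < r) : profile n p r = zp (pConj p) 0 (epsExp n p) r := by
  have h : 0 < r ^ pConj p := Real.rpow_pos_of_pos hr _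
  rw [profile, zp, Real.rpow_zero, one_mul, one_sub_zc hr, one_div,
    Real.inv_rpow (by positivity), epsExp, Real.rpow_neg (by positivity)]

/-- The function whose integral normalises `v` is integrable: it decays like
`|x| ^ (-n p')`, and `p' > 1`. -/
lemma integrable_profile_rpow (hp : 2 ≤ p) (hpn : p < n) :
    Integrable (fun x : EuclideanSpace ℝ (Fin n) => profile n p ‖x‖ ^ pStar n p) := by
  have hq := pConj_pos hp
  have hn : (0 : ℝ) < n := by linarith
  have hqn : (Module.finrank ℝ (EuclideanSpace ℝ (Fin n)) : ℝ) < pConj p * n := by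
    rw [finrank_euclideanSpace_fin]
    have : 1 < pConj p := by
      rw [pConj, one_lt_div (by linarith)]
      linarith
    nlinarith
  have hform : ∀ t : ℝ, 0 ≤ t → profile n p t ^ pStar n p = (1 + t ^ pConj p) ^ (-(n : ℝ)) := by
    intro t ht
    rw [profile, ← Real.rpow_mul (by positivity), pStar]
    congr 1
    have h1 : (n : ℝ) - p ≠ 0 := by linarith
    have h2 : p ≠ 0 := by linarith
    field_simp
  refine Integrable.mono' ((integrable_one_add_norm (μ := volume) hqn).const_mul
    ((2 ^ pConj p) ^ (n : ℝ))) ?_ (ae_of_all _ fun x => ?_)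
  · have h1 : Continuous fun x : EuclideanSpace ℝ (Fin n) =>
        (1 + ‖x‖ ^ pConj p) ^ (-(n : ℝ)) := by
      refine Continuous.rpow_const (continuous_const.add
        (continuous_norm.rpow_const fun _ => Or.inr hq.le)) fun x => Or.inl ?_
      positivity
    simp only [hform _ (norm_nonneg _)]
    exact h1.aestronglyMeasurable
  · rw [hform _ (norm_nonneg _), Real.norm_of_nonneg (by positivity)]
    set t := ‖x‖
    have ht : 0 ≤ t := norm_nonneg x
    have h1 : (1 + t) ^ pConj p ≤ 2 ^ pConj p * (1 + t ^ pConj p) := by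
      rcases le_total t 1 with h | h
      · calc (1 + t) ^ pConj p ≤ 2 ^ pConj p :=
              Real.rpow_le_rpow (by linarith) (by linarith) hq.le
          _ ≤ _ := le_mul_of_one_le_right (by positivity)
              (le_add_of_nonneg_right (by positivity))
      · calc (1 + t) ^ pConj p ≤ (2 * t) ^ pConj p :=
              Real.rpow_le_rpow (by linarith) (by linarith) hq.le
          _ = 2 ^ pConj p * t ^ pConj p := Real.mul_rpow (by norm_num) ht
          _ ≤ _ := by gcongr; linarith
    have h2 := Real.rpow_le_rpow (by positivity) h1 hn.le
    rw [Real.mul_rpow (by positivity) (by positivity), ← Real.rpow_mul (by positivity)] at h2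
    rw [Real.rpow_neg (by positivity),
      Real.rpow_neg (by positivity), ← div_eq_mul_inv, inv_eq_one_div,
      div_le_div_iff₀ (by positivity) (by positivity)]
    linarith

lemma kappa_pos (hp : 2 ≤ p) (hpn : p < n) : 0 < kappa n p := by
  have hpos : ∀ x : EuclideanSpace ℝ (Fin n), 0 < profile n p ‖x‖ ^ pStar n p := fun x => by
    unfold profile
    positivity
  refine Real.rpow_pos_of_pos ?_ _
  rw [integral_pos_iff_support_of_nonneg (fun x => (hpos x).le) (integrable_profile_rpow hp hpn)]
  have : Function.support (fun x : EuclideanSpace ℝ (Fin n) => profile n p ‖x‖ ^ pStar n p)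
      = univ := by
    ext x
    simp [(hpos x).ne']
  rw [this]
  exact Measure.measure_univ_pos.2 (NeZero.ne _)

lemma gradConst_pos (hp : 2 ≤ p) (hpn : p < n) : 0 < gradConst n p :=
  Real.rpow_pos_of_pos (mul_pos (mul_pos (kappa_pos hp hpn) (pConj_pos hp)) (epsExp_pos hp hpn)) _

lemma massConst_pos (hp : 2 ≤ p) (hpn : p < n) : 0 < massConst n p :=
  Real.rpow_pos_of_pos (kappa_pos hp hpn) _

/-- Powers of `r` are powers of `z / (1 - z)`. -/
lemma rpow_eq_zp (hp : 2 ≤ p) (hr : 0 < r) (a : ℝ) :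
    r ^ a = zp (pConj p) (a / pConj p) (-(a / pConj p)) r := by
  have hq := pConj_pos hp
  have h : 0 < r ^ pConj p := Real.rpow_pos_of_pos hr _
  rw [zp, one_sub_zc hr, Real.rpow_neg (by positivity), ← Real.inv_rpow (by positivity),
    ← Real.mul_rpow (zc_pos hr).le (by positivity), zc]
  have : r ^ pConj p / (1 + r ^ pConj p) * (1 / (1 + r ^ pConj p))⁻¹ = r ^ pConj p := by
    field_simp
  rw [this, ← Real.rpow_mul hr.le, mul_div_cancel₀ _ hq.ne']

lemma abs_deriv_v (hp : 2 ≤ p) (hpn : p < n) (hr : 0 < r) :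
    |deriv (v n p) r| = kappa n p * pConj p * epsExp n p
      * (zp (pConj p) 1 (epsExp n p) r * r ^ (-1 : ℝ)) := by
  have hev : v n p =ᶠ[𝓝 r] fun r => kappa n p * zp (pConj p) 0 (epsExp n p) r := by
    filter_upwards [Ioi_mem_nhds hr] with x hx
    rw [v, profile_eq_zp hx]
  have hd := ((hasDerivAt_zp (q := pConj p) (a := 0) (b := epsExp n p) hr).const_mul
    (kappa n p)).congr_of_eventuallyEq hev
  have h1 : zp (pConj p) 1 (epsExp n p) r = zc (pConj p) r * zp (pConj p) 0 (epsExp n p) r := by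
    simp [zp]
  rw [hd.deriv, h1, Real.rpow_neg_one, ← abs_neg, abs_of_nonneg]
  · field_simp
    ring
  · have := kappa_pos hp hpn
    have := pConj_pos hp
    have := epsExp_pos hp hpn
    have := zc_pos (q := pConj p) hr
    have := zp_pos (q := pConj p) (a := 0) (b := epsExp n p) hr
    have e : -(kappa n p * (pConj p / r * (0 * (1 - zc (pConj p) r) - epsExp n p * zc (pConj p) r)
        * zp (pConj p) 0 (epsExp n p) r))
        = kappa n p * (pConj p / r * (epsExp n p * zc (pConj p) r)
        * zp (pConj p) 0 (epsExp n p) r) := by ring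
    rw [e]
    positivity

lemma zp_rpow {q a b : ℝ} (hr : 0 < r) (c : ℝ) : zp q a b r ^ c = zp q (a * c) (b * c) r := by
  rw [zp, Real.mul_rpow (Real.rpow_nonneg (zc_pos hr).le _)
    (Real.rpow_nonneg (one_sub_zc_pos hr).le _), ← Real.rpow_mul (zc_pos hr).le,
    ← Real.rpow_mul (one_sub_zc_pos hr).le, zp]

lemma three_le_of_lt (hp : 2 ≤ p) (hpn : p < n) : 3 ≤ n := by
  have : 2 < n := by exact_mod_cast hp.trans_lt hpn
  exact this

/-- In terms of `z`, the gradient weight is a constant times `r z ^ β (1 - z) ^ (-ε)`. -/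
lemma gradWeight_eq (hp : 2 ≤ p) (hpn : p < n) (hr : 0 < r) :
    gradWeight n p r = gradConst n p * (r * zp (pConj p) (betaExp n p) (-epsExp n p) r) := by
  have hκ := kappa_pos hp hpn
  have hq := pConj_pos hp
  have hε := epsExp_pos hp hpn
  have hn := three_le_of_lt hp hpn
  have hz := zp_pos (q := pConj p) (a := 1) (b := epsExp n p) hr
  have h1 : (r : ℝ) ^ (n - 1) = r ^ ((n : ℝ) - 1) := by
    rw [← Real.rpow_natCast, Nat.cast_sub (by omega), Nat.cast_one]
  have h2 : (r ^ (-1 : ℝ)) ^ (p - 2) * r ^ ((n : ℝ) - 1) = r * r ^ ((n : ℝ) - p) := by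
    nth_rw 3 [← Real.rpow_one r]
    rw [← Real.rpow_mul hr.le, ← Real.rpow_add hr, ← Real.rpow_add hr]
    congr 1
    ring
  rw [gradWeight, abs_deriv_v hp hpn hr, Real.mul_rpow (by positivity) (by positivity),
    Real.mul_rpow hz.le (by positivity), h1, ← gradConst, mul_assoc,
    mul_assoc (zp _ _ _ _ ^ (p - 2)), h2, zp_rpow hr,
    rpow_eq_zp hp hr ((n : ℝ) - p), mul_left_comm _ r, zp_mul hr]
  have hp0 : p ≠ 0 := by linarith
  have hp1 : p - 1 ≠ 0 := by linarith
  congr 3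
  · rw [pConj, betaExp]
    field_simp
    ring
  · rw [pConj, epsExp]
    field_simp
    ring

/-- In terms of `z`, the weight `w` is a constant times `z ^ (β + 1) (1 - z) ^ (1 - ε) / r`. -/
lemma w_eq (hp : 2 ≤ p) (hpn : p < n) (hr : 0 < r) :
    w n p r = massConst n p * wt (pConj p) (betaExp n p) (epsExp n p) r := by
  have hκ := kappa_pos hp hpn
  have hn := three_le_of_lt hp hpn
  have hz := zp_pos (q := pConj p) (a := 0) (b := epsExp n p) hr
  have h1 : (r : ℝ) ^ (n - 1) = r ^ (n : ℝ) / r := by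
    rw [← Real.rpow_sub_one hr.ne', ← Real.rpow_natCast, Nat.cast_sub (by omega), Nat.cast_one]
  rw [w, v, profile_eq_zp hr, Real.mul_rpow hκ.le hz.le, zp_rpow hr, h1,
    rpow_eq_zp hp hr (n : ℝ), ← massConst, mul_assoc, mul_div_assoc', zp_mul hr, wt]
  have hp0 : p ≠ 0 := by linarith
  have hp1 : p - 1 ≠ 0 := by linarith
  have hnp : (n : ℝ) - p ≠ 0 := by linarith
  congr 3
  · rw [pConj, betaExp]
    field_simp
    ring
  · rw [pConj, epsExp, pStar]
    field_simp
    ring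

lemma P_eq : P n p r = (p - 1) * gradWeight n p r := by
  rw [P, gradWeight, mul_assoc]

lemma Q_eq (hp : 2 ≤ p) (hpn : p < n) (hr : 0 < r) :
    Q n p μ r = μ * gradWeight n p r / r ^ 2 := by
  have hn := three_le_of_lt hp hpn
  obtain ⟨k, rfl⟩ : ∃ k, n = k + 3 := ⟨n - 3, by omega⟩
  rw [Q, gradWeight, show k + 3 - 3 = k by omega, show k + 3 - 1 = k + 2 by omega]
  field_simp
  ring

/-! ### Eigenfunctions as solutions of the normalised equation -/

/-- The parameter `m` of the normalised equation `IsSol`. -/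
def mParam (p μ : ℝ) : ℝ := μ / ((p - 1) * pConj p ^ 2)

/-- The factor between the parameter `l` of the normalised equation `IsSol` and the eigenvalue. -/
def lamScale (n : ℕ) (p : ℝ) : ℝ := (p - 1) * gradConst n p * pConj p ^ 2 / massConst n p

lemma lamScale_pos (hp : 2 ≤ p) (hpn : p < n) : 0 < lamScale n p :=
  div_pos (mul_pos (mul_pos (by linarith) (gradConst_pos hp hpn)) (pow_pos (pConj_pos hp) 2))
    (massConst_pos hp hpn)

/-- The normalised equation is the eigenvalue equation divided by `(p - 1) * gradConst n p`. -/
lemma isSol_iff (hp : 2 ≤ p) (hpn : p < n) {l : ℝ} {f : ℝ → ℝ} :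
    IsSol (pConj p) (betaExp n p) (epsExp n p) (mParam p μ) l f ↔
      ∀ r, 0 < r → DifferentiableAt ℝ f r ∧
        DifferentiableAt ℝ (fun s => P n p s * deriv f s) r ∧
        deriv (fun s => P n p s * deriv f s) r - Q n p μ r * f r
          + lamScale n p * l * w n p r * f r = 0 := by
  have hK := gradConst_pos hp hpn
  have hN := massConst_pos hp hpn
  have hq := pConj_pos hp
  have hp1 : 0 < p - 1 := by linarith
  set c := (p - 1) * gradConst n p with hc
  have hc0 : 0 < c := mul_pos hp1 hK
  refine forall₂_congr fun r hr => and_congr_right fun _ => ?_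
  set F : ℝ → ℝ := fun s => s * zp (pConj p) (betaExp n p) (-epsExp n p) s * deriv f s
  have hev : (fun s => P n p s * deriv f s) =ᶠ[𝓝 r] fun s => c * F s := by
    filter_upwards [Ioi_mem_nhds hr] with s hs
    rw [P_eq, gradWeight_eq hp hpn hs]
    simp only [F, hc]
    ring
  have hwt : zp (pConj p) (betaExp n p + 1) (1 - epsExp n p) r
      = zp (pConj p) 1 1 r * zp (pConj p) (betaExp n p) (-epsExp n p) r := by
    rw [zp_mul hr]
    congr 1
    ring
  have hrhs : Q n p μ r * f r - lamScale n p * l * w n p r * f r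
      = c * (pConj p ^ 2 * (mParam p μ - l * zp (pConj p) 1 1 r)
        * zp (pConj p) (betaExp n p) (-epsExp n p) r / r * f r) := by
    rw [Q_eq hp hpn hr, gradWeight_eq hp hpn hr, w_eq hp hpn hr, wt, hwt, lamScale, mParam, hc]
    field_simp
  have hd : DifferentiableAt ℝ (fun s => P n p s * deriv f s) r ↔ DifferentiableAt ℝ F r := by
    rw [hev.differentiableAt_iff]
    refine ⟨fun h => ?_, fun h => h.const_mul c⟩
    have := h.const_mul c⁻¹
    simpa only [inv_mul_cancel_left₀ hc0.ne'] using this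
  rw [hd, hev.deriv_eq, deriv_const_mul_field]
  constructor
  · intro h
    exact ⟨h.differentiableAt, by rw [h.deriv]; linarith⟩
  · rintro ⟨h1, h2⟩
    have h3 : deriv F r = pConj p ^ 2 * (mParam p μ - l * zp (pConj p) 1 1 r)
        * zp (pConj p) (betaExp n p) (-epsExp n p) r / r * f r :=
      mul_left_cancel₀ hc0.ne' (by linarith)
    rw [← h3]
    exact h1.hasDerivAt

/-- The larger exponent of the equation at `z = 0`. -/
def sExp (n : ℕ) (p μ : ℝ) : ℝ :=
  (-betaExp n p + √(betaExp n p ^ 2 + 4 * mParam p μ)) / 2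

/-- The larger exponent of the equation at `z = 1`. -/
def tauExp (n : ℕ) (p μ : ℝ) : ℝ :=
  (epsExp n p + √(epsExp n p ^ 2 + 4 * mParam p μ)) / 2

lemma exponents (hp : 2 ≤ p) (hpn : p < n) (hμ : 0 ≤ μ) :
    Exponents (betaExp n p) (epsExp n p) (mParam p μ) (sExp n p μ) (tauExp n p μ) := by
  have hβ := betaExp_pos hp hpn
  have hε := epsExp_pos hp hpn
  have hm : 0 ≤ mParam p μ :=
    div_nonneg hμ (mul_nonneg (by linarith) (sq_nonneg _))
  have h1 : betaExp n p ≤ √(betaExp n p ^ 2 + 4 * mParam p μ) :=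
    Real.le_sqrt_of_sq_le (by linarith)
  have h2 : epsExp n p ≤ √(epsExp n p ^ 2 + 4 * mParam p μ) :=
    Real.le_sqrt_of_sq_le (by linarith)
  have h3 := Real.sq_sqrt (show 0 ≤ betaExp n p ^ 2 + 4 * mParam p μ by positivity)
  have h4 := Real.sq_sqrt (show 0 ≤ epsExp n p ^ 2 + 4 * mParam p μ by positivity)
  refine ⟨hβ, hε, ?_, ?_, ?_, ?_⟩ <;> simp only [sExp, tauExp]
  · linarith
  · linarith
  · linear_combination h3 / 4
  · linear_combination h4 / 4

/-- The eigenvalues in increasing order. -/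
def eigenvalueSeq (n : ℕ) (p μ : ℝ) (k : ℕ) : ℝ :=
  lamScale n p * lam (betaExp n p) (epsExp n p) (sExp n p μ) (tauExp n p μ) k

/-- The eigenfunction of `eigenvalueSeq n p μ k`. -/
def eigenfun (n : ℕ) (p μ : ℝ) (k : ℕ) : ℝ → ℝ :=
  psi (pConj p) (betaExp n p) (epsExp n p) (sExp n p μ) (tauExp n p μ) k

lemma isEigenfunction_eigenfun (hp : 2 ≤ p) (hpn : p < n) (hμ : 0 ≤ μ) (k : ℕ) :
    IsEigenfunction n p μ (eigenvalueSeq n p μ k) (eigenfun n p μ k) := by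
  have hE := exponents hp hpn hμ
  have hq := pConj_pos hp
  have h := (isSol_iff hp hpn).1 (isSol_psi (q := pConj p) hE k)
  exact ⟨exists_psi_ne_zero hq k,
    memW0_of_regularBound hq hE.hβ hE.hε (gradConst_pos hp hpn) (massConst_pos hp hpn)
      (fun r hr => w_eq hp hpn hr) (fun r hr => gradWeight_eq hp hpn hr)
      (fun r hr => contDiffAt_zpoly _ hr) (regularBound_psi hq hE k),
    fun r hr => (h r hr).1, fun r hr => (h r hr).2.1, fun r hr => (h r hr).2.2⟩

lemma IsEigenfunction.exists_eq (hp : 2 ≤ p) (hpn : p < n) (hμ : 0 ≤ μ) {f : ℝ → ℝ}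
    (hf : IsEigenfunction n p μ α f) :
    ∃ k, α = eigenvalueSeq n p μ k ∧ ∃ c, c ≠ 0 ∧ ∀ r, 0 < r → f r = c * eigenfun n p μ k r := by
  have hE := exponents hp hpn hμ
  have hq := pConj_pos hp
  have hL := (lamScale_pos hp hpn).ne'
  have hsol : IsSol (pConj p) (betaExp n p) (epsExp n p) (mParam p μ) (α / lamScale n p) f := by
    refine (isSol_iff hp hpn).2 fun r hr =>
      ⟨hf.differentiable r hr, hf.flux_differentiable r hr, ?_⟩
    rw [mul_div_cancel₀ _ hL]
    exact hf.equation r hr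
  have hbound : EnergyBound (pConj p) (betaExp n p) (epsExp n p) f := by
    refine energyBound_of_memW0 hq hE.hβ hE.hε (gradConst_pos hp hpn) (fun r hr => ?_) ?_
      (fun r hr => gradWeight_eq hp hpn hr) hf.mem hsol.continuousOn
    · rw [w_eq hp hpn hr]
      exact mul_pos (massConst_pos hp hpn) (wt_pos hr)
    · exact (continuousOn_const.mul continuousOn_wt).congr fun r hr => w_eq hp hpn hr
  obtain ⟨k, hk, c, hc, hfc⟩ := exists_eq_psi hq hE hsol hbound hf.nontrivial
  exact ⟨k, by rw [eigenvalueSeq, ← hk, mul_div_cancel₀ _ hL], c, hc, hfc⟩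

lemma eigenvalueSeq_strictMono (hp : 2 ≤ p) (hpn : p < n) (hμ : 0 ≤ μ) :
    StrictMono (eigenvalueSeq n p μ) :=
  (lam_strictMono (exponents hp hpn hμ)).const_mul (lamScale_pos hp hpn)

end

end RadialSL

theorem lemma6p4 (n : ℕ) (p μ : ℝ) (hp : 2 ≤ p) (hpn : p < n) (hμ : 0 ≤ μ) :
    -- eigenfunctions are continuous up to `0`
    (∀ (α : ℝ) (f : ℝ → ℝ), RadialSL.IsEigenfunction n p μ α f →
      ∃ l : ℝ, Tendsto f (𝓝[>] 0) (𝓝 l)) ∧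
    -- every eigenspace is one-dimensional
    (∀ (α : ℝ) (f₁ f₂ : ℝ → ℝ),
      RadialSL.IsEigenfunction n p μ α f₁ → RadialSL.IsEigenfunction n p μ α f₂ →
        ∃ c : ℝ, ∀ r, 0 < r → f₁ r = c * f₂ r) ∧
    -- the eigenvalues form a sequence `a 0 < a 1 < a 2 < ⋯` tending to infinity, and the
    -- eigenfunction of `a i` (the one of index `i + 1` when counted from one) has `i` interior zeros
    ∃ a : ℕ → ℝ, StrictMono a ∧ Tendsto a atTop atTop ∧
      RadialSL.eigenvalues n p μ = Set.range a ∧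
      ∀ (i : ℕ) (f : ℝ → ℝ), RadialSL.IsEigenfunction n p μ (a i) f →
        {r : ℝ | 0 < r ∧ f r = 0}.encard = (i : ℕ∞) := by
  have hE := RadialSL.exponents hp hpn hμ
  have hq := RadialSL.pConj_pos hp
  have hmono := RadialSL.eigenvalueSeq_strictMono hp hpn hμ
  refine ⟨fun α f hf => ?_, fun α f₁ f₂ h₁ h₂ => ?_, RadialSL.eigenvalueSeq n p μ, hmono,
    (JacobiModel.tendsto_lam hE).const_mul_atTop (RadialSL.lamScale_pos hp hpn), ?_, fun i f hf => ?_⟩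
  · obtain ⟨k, -, c, -, hfc⟩ := hf.exists_eq hp hpn hμ
    obtain ⟨x, hx⟩ := JacobiModel.exists_tendsto_psi hq hE k
    refine ⟨c * x, (hx.const_mul c).congr' ?_⟩
    filter_upwards [self_mem_nhdsWithin] with r hr using (hfc r hr).symm
  · obtain ⟨k, hk, c₁, -, hf₁⟩ := h₁.exists_eq hp hpn hμ
    obtain ⟨j, hj, c₂, hc₂, hf₂⟩ := h₂.exists_eq hp hpn hμ
    obtain rfl : k = j := hmono.injective (hk.symm.trans hj)
    refine ⟨c₁ / c₂, fun r hr => ?_⟩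
    rw [hf₁ r hr, hf₂ r hr, ← mul_assoc, div_mul_cancel₀ _ hc₂]
  · ext α
    constructor
    · rintro ⟨f, hf⟩
      obtain ⟨k, hk, -⟩ := hf.exists_eq hp hpn hμ
      exact ⟨k, hk.symm⟩
    · rintro ⟨k, rfl⟩
      exact ⟨_, RadialSL.isEigenfunction_eigenfun hp hpn hμ k⟩
  · obtain ⟨k, hk, c, hc, hfc⟩ := hf.exists_eq hp hpn hμ
    obtain rfl : i = k := hmono.injective hk
    rw [← JacobiModel.encard_zeros_psi hq hE i]
    congr 1
    ext r
    refine and_congr_right fun hr => ?_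
    rw [hfc r hr]
    exact mul_eq_zero_iff_left hc
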